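/- Let $d\ge 2$ and $\beta=d+\tfrac12$. **Process.** Let $\varepsilon(\mathbf j)$, $\mathbf j\in\mathbb Z^d$, be independent random variables with mean $0$ and variance $1$ such that $\{\varepsilon(\mathbf j)^2\}$ is uniformly integrable. Let $\alpha:\mathbb Z^d\to\mathbb R$ satisfy $\sum_{\mathbf i}\alpha(\mathbf i)^2<\infty$, let $\mu\in\mathbb R$, and let $Z(\mathbf i)=\mu+\sum_{\mathbf j\in\mathbb Z^d}\alpha(\mathbf i-\mathbf j)\varepsilon(\mathbf j)$, with convergence in $L^2$. **Regions.** Let $R_0\subset(-\tfrac12,\tfrac12]^d$ be open and connected with $\mathbf 0\in R_0$ and $\partial R_0$ of Lebesgue measure zero. Let $\lambda_n>0$ with $\lambda_n\to\infty$, and put $R_n=\lambda_nR_0$, $S_n=\sum_{\mathbf i\in R_n\cap\mathbb Z^d}Z(\mathbf i)$ and $\theta_n(\mathbf i)=\sum_{\mathbf j\in[R_n-\mathbf i]\cap\mathbb Z^d}\alpha(\mathbf j)$. **Standing hypotheses.** Let $\lfloor\cdot\rfloor$ act coordinatewise, let $\|\cdot\|$ be the Euclidean norm, and let $\gamma(t)=\max\{|\alpha(\lfloor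 \mathbf u t\rfloor)|:\|\mathbf u\|=1\}$. Assume: 1. (C.1) $\gamma(t)=t^{-\beta}L(t)$ for all $t>0$, where $L:(0,\infty)\to[0,\infty)$ is bounded on bounded subintervals, positive for all large $t$, and $\lim_{t\to\infty}\sup\{L(at)/L(t):a\in[a_0,a_1]\}=1$ for all $0<a_0<a_1<\infty$. 2. $A:=\sum_{\mathbf i\in\mathbb Z^d}\alpha(\mathbf i)=0$. 3. (e-cond) For some $\sigma_{\rm EE}^2\in(0,\infty)$, $$\lim_{\delta\downarrow0}\limsup_{n\to\infty}\Bigl|\lambda_n^{-(d-1)}\sum_{\mathbf i\in[\partial R_n]^{\delta\lambda_n}\cap\mathbb Z^d}|\theta_n(\mathbf i)|^2-\sigma_{\rm EE}^2\Bigr|=0,$$ where $B^\eta=\{\mathbf y:\|\mathbf z-\mathbf y\|\le\eta\text{ for some }\mathbf z\in B\}$. Below, $\to^d$ denotes convergence in distribution as $n\to\infty$, and $N(0,0)$ is the point mass at $0$. **(i)** If $L(t)\to0$ as $t\to\infty$, then $\lambda_n^{-(d-1)/2}[S_n-ES_n]\to^d N(0,\sigma_{\rm EE}^2)$. **(ii)**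 Suppose in addition that * (C.2) $g_\infty:\mathbb R^d\to\mathbb R$ is a measurable function such that, with $g_t(\mathbf x)=\alpha(\lfloor t\mathbf x\rfloor)/\gamma(t)$, $\int_{\{\|\mathbf x\|\ge\delta\}}|g_t(\mathbf x)-g_\infty(\mathbf x)|^b\,d\mathbf x\to0$ as $t\to\infty$ for every $\delta>0$, where $b=2$ if $\beta\le d$ and $b=1$ otherwise (so here $b=1$); * $G^\dagger_\infty\in L^2(\mathbb R^d)$, where $G_\infty^\dagger(\mathbf x)=\int_{R_0}g_\infty(\mathbf y-\mathbf x)\,d\mathbf y$ for $\mathbf x\notin R_0\cup\partial R_0$, $G_\infty^\dagger(\mathbf x)=\int_{R_0^c}g_\infty(\mathbf y-\mathbf x)\,d\mathbf y$ for $\mathbf x\in R_0$, and $G_\infty^\dagger(\mathbf x)=0$ for $\mathbf x\in\partial R_0$. Then: (a) If $L(t)\to c_0$ as $t\to\infty$ for some $c_0\in(0,\infty)$, then $$\lambda_n^{-(d-1)/2}[S_n-ES_n]\to^d N\Bigl(0,\ \sigma_{\rm EE}^2+c_0^2\int_{\mathbb R^d}[G^\dagger_\infty(\mathbf x)]^2\,d\mathbf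 x\Bigr).$$ (b) If $L(t)\to\infty$ as $t\to\infty$, then $$\frac{S_n-ES_n}{[\lambda_n^{3d-2\beta}L^2(\lambda_n)]^{1/2}}\to^d N\Bigl(0,\ \int_{\mathbb R^d}[G^\dagger_\infty(\mathbf x)]^2\,d\mathbf x\Bigr).$$ -/

import Mathlib

open MeasureTheory ProbabilityTheory Filter Topology Set
open scoped ENNReal NNReal Pointwise

noncomputable section

namespace SpatialCLT

/-- The integer lattice `ℤ^d`. -/
abbrev Lattice (d : ℕ) : Type := Fin d → ℤ

/-- Euclidean space `ℝ^d`, with the Euclidean norm. -/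
abbrev Space (d : ℕ) : Type := EuclideanSpace ℝ (Fin d)

variable {d : ℕ}

/-- A lattice site, as a point of `ℝ^d`. -/
def toSpace (k : Lattice d) : Space d := WithLp.toLp 2 (fun i => (k i : ℝ))

/-- The coordinatewise integer part `⌊x⌋`. -/
def floorVec (x : Space d) : Lattice d := fun i => ⌊x i⌋

/-! ### The linear process -/

/-- Independent innovations with mean `0` and variance `1` whose squares are uniformly integrable
(they need not be identically distributed). -/
structure IsInnovationField {Ω : Type*} [MeasurableSpace Ω] (P : Measure Ω)
    (ε : Lattice d → Ω → ℝ) : Prop where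
  measurable : ∀ j, Measurable (ε j)
  indep : iIndepFun ε P
  memLp : ∀ j, MemLp (ε j) 2 P
  mean_zero : ∀ j, ∫ ω, ε j ω ∂P = 0
  variance_one : ∀ j, Var[ε j; P] = 1
  sq_uniformIntegrable : UniformIntegrable (fun j ω => ε j ω ^ 2) 1 P

/-- `Z(i) = μ + ∑_{j ∈ ℤ^d} α(i - j) ε(j)` for every `i`, the series converging
(unconditionally) in `L²`. -/
structure IsLinearProcess {Ω : Type*} [MeasurableSpace Ω] (P : Measure Ω) (μ : ℝ)
    (α : Lattice d → ℝ) (ε : Lattice d → Ω → ℝ) (Z : Lattice d → Ω → ℝ) : Prop where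
  aemeasurable : ∀ i, AEMeasurable (Z i) P
  tendsto_partialSums : ∀ i, Tendsto
    (fun s : Finset (Lattice d) =>
      eLpNorm (fun ω => Z i ω - (μ + ∑ j ∈ s, α (i - j) * ε j ω)) 2 P) atTop (𝓝 0)

/-! ### Sampling regions -/

/-- The prototype sampling region: an open connected subset of `(-1/2, 1/2]^d` that contains the
origin and has a Lebesgue-null boundary. -/
structure IsPrototypeRegion (R₀ : Set (Space d)) : Prop where
  isOpen : IsOpen R₀
  isConnected : IsConnected R₀
  subset_cube : ∀ x ∈ R₀, ∀ i, x i ∈ Ioc (-(1 / 2) : ℝ) (1 / 2)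
  zero_mem : (0 : Space d) ∈ R₀
  volume_frontier : volume (frontier R₀) = 0

/-- The data sites `R ∩ ℤ^d`, as a set of lattice sites. -/
def dataSites (R : Set (Space d)) : Set (Lattice d) := {k | toSpace k ∈ R}

/-- `S = ∑_{i ∈ R ∩ ℤ^d} Z(i)`; the set of summation is finite when `R` is bounded. -/
def siteSum {Ω : Type*} (Z : Lattice d → Ω → ℝ) (R : Set (Space d)) (ω : Ω) : ℝ :=
  ∑ᶠ i ∈ dataSites R, Z i ω

/-- `θ(i) = ∑_{j ∈ [R - i] ∩ ℤ^d} α(j)`; the set of summation is finite when `R` is bounded. -/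
def theta (α : Lattice d → ℝ) (R : Set (Space d)) (i : Lattice d) : ℝ :=
  ∑ᶠ j ∈ dataSites ((fun x => x - toSpace i) '' R), α j

/-- The closed enlargement `A^δ = {y : ‖z - y‖ ≤ δ for some z ∈ A}`. -/
def enlargement (A : Set (Space d)) (δ : ℝ) : Set (Space d) := {y | ∃ z ∈ A, ‖z - y‖ ≤ δ}

/-! ### Regularity of the coefficients -/

/-- `γ(t) = max {|α(⌊u t⌋)| : ‖u‖ = 1}` (over finitely many values, so the supremum is attained). -/
def radialMax (α : Lattice d → ℝ) (t : ℝ) : ℝ :=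
  sSup ((fun u : Space d => |α (floorVec (t • u))|) '' {u | ‖u‖ = 1})

/-- Slow variation at infinity of a function `L : (0, ∞) → [0, ∞)`; only the values on `(0, ∞)`
matter. -/
structure IsSlowlyVarying (L : ℝ → ℝ) : Prop where
  nonneg : ∀ t, 0 < t → 0 ≤ L t
  pos_eventually : ∀ᶠ t in atTop, 0 < L t
  bounded : ∀ b : ℝ, 0 < b → ∃ C : ℝ, ∀ t ∈ Ioc 0 b, L t ≤ C
  tendsto_ratio : ∀ a₀ a₁ : ℝ, 0 < a₀ → a₀ < a₁ →
    Tendsto (fun t => sSup ((fun a => L (a * t) / L t) '' Icc a₀ a₁)) atTop (𝓝 1)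

/-- The radial maximum is regularly varying: `γ(t) = t^{-β} L(t)` with `β > d/2` and `L` slowly
varying. -/
structure RegularRadialDecay (α : Lattice d → ℝ) (β : ℝ) (L : ℝ → ℝ) : Prop where
  half_dim_lt : (d : ℝ) / 2 < β
  slowlyVarying : IsSlowlyVarying L
  radialMax_eq : ∀ t, 0 < t → radialMax α t = t ^ (-β) * L t

/-- The rescaled coefficient function `g_t(x) = α(⌊t x⌋) / γ(t)`. -/
def rescaledCoeff (α : Lattice d → ℝ) (t : ℝ) (x : Space d) : ℝ :=
  α (floorVec (t • x)) / radialMax α t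

/-- The exponent `b(d, β)`: `2` if `β ≤ d`, and `1` otherwise. -/
def limitExponent (d : ℕ) (β : ℝ) : ℕ := if β ≤ d then 2 else 1

/-- `g` is a limit function of the coefficients:
`∫_{‖x‖ ≥ δ} |g_t(x) - g(x)|^b dx → 0` as `t → ∞`, for every `δ > 0`. -/
structure IsCoeffLimit (α : Lattice d → ℝ) (β : ℝ) (g : Space d → ℝ) : Prop where
  aemeasurable : AEMeasurable g volume
  tendsto_lintegral : ∀ δ : ℝ, 0 < δ →
    Tendsto (fun t : ℝ => ∫⁻ x in {x : Space d | δ ≤ ‖x‖},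
      ENNReal.ofReal (|rescaledCoeff α t x - g x| ^ limitExponent d β)) atTop (𝓝 0)

open Classical in
/-- The function `G†`: it is `∫_{R₀} g(y - x) dy` for `x` outside `R₀ ∪ ∂R₀`,
`∫_{R₀ᶜ} g(y - x) dy` for `x ∈ R₀`, and `0` for `x ∈ ∂R₀`. -/
def daggerG (R₀ : Set (Space d)) (g : Space d → ℝ) (x : Space d) : ℝ :=
  if x ∈ R₀ then ∫ y in R₀ᶜ, g (y - x)
  else if x ∈ frontier R₀ then 0
  else ∫ y in R₀, g (y - x)

/-! ### The edge-effect condition and the mode of convergence -/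

/-- `lim_{δ ↓ 0} limsup_n |λ_n^{-(d-1)} ∑_{i ∈ [∂R_n]^{δ λ_n} ∩ ℤ^d} θ_n(i)² - σ²| = 0`, where
`R_n = λ_n R₀`. The upper limit is taken in `[0, ∞]`; each sum is over a finite set. -/
def EdgeCondition (α : Lattice d → ℝ) (R₀ : Set (Space d)) (lam : ℕ → ℝ) (σ2 : ℝ) : Prop :=
  Tendsto (fun δ : ℝ => limsup (fun n : ℕ => ENNReal.ofReal
      |lam n ^ (-((d : ℝ) - 1)) *
        (∑ᶠ i ∈ dataSites (enlargement (frontier (lam n • R₀)) (δ * lam n)),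
          |theta α (lam n • R₀) i| ^ 2) - σ2|) atTop)
    (𝓝[>] 0) (𝓝 0)

/-- `X_n` converges in distribution to `N(0, v)`; for `v = 0` this is the point mass at `0`. -/
def TendstoNormal {Ω : Type*} [MeasurableSpace Ω] (P : Measure Ω) [IsProbabilityMeasure P]
    (X : ℕ → Ω → ℝ) (v : ℝ) : Prop :=
  TendstoInDistribution X atTop (id : ℝ → ℝ) (fun _ => P) (gaussianReal 0 v.toNNReal)

end SpatialCLT

end

/-! The centred sum is `∑ j, θ_n(j) ε(j)`, where `θ_n(j)` adds up `α(k - j)` over the sites `k` of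
`R_n`. Since `α` is summable, `|θ_n| ≤ ∑ |α|` for all sites and all `n`. A normalisation tending to
zero therefore makes every single weight negligible, and Lindeberg's theorem
(`IsInnovationField.tendstoNormal_sum`, `IsLinearProcess.tendstoNormal`) reduces everything to the
limit of the rescaled `∑ θ_n²`.

Since `∑ α = 0`, `θ_n(i)` is the sum of `α(k)` times the increment of the indicator of `R_n` from
`i` to `i + k` (`integral_incr_gridPoint`), so only lags that cross the boundary count. Sites within
`δ λ_n` of the boundary contribute `σ²` by the edge condition. For the others only lags longer than
`δ λ_n` matter. There the rescaled coefficients converge in `L¹` to a kernel `h`, whatever happens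
near the origin, and the far part of `∑ θ_n²` becomes `∫ (G†)²` (`eventually_farSites_sum_close`).

With `β = d + 1/2` both parts live on the scale `λ^(d-1)`, up to the factor `L²` on the far one.
`tendsto_variance` treats all regimes at once through a factor `r n → r₀` and gives `r₀² σ² + ∫
(G†)²`. The choices are `r = 1`, `h = 0` when `L → 0`, and `r = 1 / L`, `h = g` otherwise. -/

namespace SpatialCLT

/-! ### Lindeberg's theorem through characteristic functions. -/

/-- Second-order Taylor bound for the complex exponential on the imaginary axis. -/
lemma norm_exp_mul_I_sub_taylor_le (x : ℝ) :
    ‖Complex.exp (x * Complex.I) - (1 + x * Complex.I - (x : ℂ) ^ 2 / 2)‖ ≤ 4 * x ^ 2 ∧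
    ‖Complex.exp (x * Complex.I) - (1 + x * Complex.I - (x : ℂ) ^ 2 / 2)‖ ≤ 4 * |x| ^ 3 := by
  rcases le_total |x| 1 with h | h
  · have hb := Complex.exp_bound (x := x * Complex.I) (by simpa using h) (n := 3) (by norm_num)
    have hs : ∑ m ∈ Finset.range 3, ((x : ℂ) * Complex.I) ^ m / (m.factorial : ℂ)
        = 1 + x * Complex.I - (x : ℂ) ^ 2 / 2 := by
      simp [Finset.sum_range_succ, mul_pow, Complex.I_sq]
      ring
    rw [hs] at hb
    have h3 : ‖(x : ℂ) * Complex.I‖ = |x| := by simp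
    rw [h3] at hb
    norm_num [Nat.factorial] at hb
    have h0 := abs_nonneg x
    have h4 : |x| ^ 3 ≤ x ^ 2 := by
      rw [← sq_abs x]; exact pow_le_pow_of_le_one h0 h (by norm_num)
    have h5 : 0 ≤ |x| ^ 3 := by positivity
    constructor <;> linarith
  · have h1 : ‖Complex.exp (x * Complex.I) - (1 + x * Complex.I - (x : ℂ) ^ 2 / 2)‖
        ≤ 1 + (1 + |x| + x ^ 2 / 2) := by
      refine (norm_sub_le _ _).trans ?_
      gcongr
      · simp [Complex.norm_exp_ofReal_mul_I]
      · refine (norm_sub_le _ _).trans ?_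
        gcongr
        · refine (norm_add_le _ _).trans ?_
          simp
        · simp
    have h4 : |x| ≤ x ^ 2 := by rw [← sq_abs x]; nlinarith
    have h5 : x ^ 2 ≤ |x| ^ 3 := by
      rw [← sq_abs x]; exact pow_le_pow_right₀ h (by norm_num)
    constructor <;> linarith

lemma norm_prod_sub_prod_le_sum {ι : Type*} (s : Finset ι) (f g : ι → ℂ)
    (hf : ∀ i ∈ s, ‖f i‖ ≤ 1) (hg : ∀ i ∈ s, ‖g i‖ ≤ 1) :
    ‖∏ i ∈ s, f i - ∏ i ∈ s, g i‖ ≤ ∑ i ∈ s, ‖f i - g i‖ := by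
  classical
  induction s using Finset.induction_on with
  | empty => simp
  | insert i s hi ih =>
    rw [Finset.prod_insert hi, Finset.prod_insert hi, Finset.sum_insert hi]
    have e : f i * ∏ j ∈ s, f j - g i * ∏ j ∈ s, g j
        = (f i - g i) * ∏ j ∈ s, f j + g i * (∏ j ∈ s, f j - ∏ j ∈ s, g j) := by ring
    rw [e]
    refine (norm_add_le _ _).trans ?_
    rw [norm_mul, norm_mul]
    have h1 : ‖∏ j ∈ s, f j‖ ≤ 1 := by
      rw [norm_prod]
      exact Finset.prod_le_one (fun _ _ => norm_nonneg _)
        fun j hj => hf j (Finset.mem_insert_of_mem hj)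
    have h2 := ih (fun j hj => hf j (Finset.mem_insert_of_mem hj))
      (fun j hj => hg j (Finset.mem_insert_of_mem hj))
    have h3 := hg i (Finset.mem_insert_self _ _)
    have := norm_nonneg (f i - g i)
    have := norm_nonneg (∏ j ∈ s, f j - ∏ j ∈ s, g j)
    nlinarith

lemma abs_exp_neg_sub_le {y : ℝ} (hy : 0 ≤ y) : |Real.exp (-y) - (1 - y)| ≤ y ^ 2 := by
  rcases le_total y 1 with h | h
  · have := Real.abs_exp_sub_one_sub_id_le (x := -y) (by rwa [abs_neg, abs_of_nonneg hy])
    rw [neg_sq] at this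
    convert this using 2
    ring
  · have h1 := Real.add_one_le_exp (-y)
    have h2 : Real.exp (-y) ≤ 1 := by simpa using hy
    rw [abs_of_nonneg (by linarith)]
    nlinarith

section CharFun

variable {Ω : Type*} [MeasurableSpace Ω] {P : Measure Ω} {d : ℕ}

/-- Truncate at `X² ≥ C`: the quadratic Taylor bound on the tail costs `η`, and the cubic bound
elsewhere uses `|X| ≤ √C`. The estimate depends on the law of `X` only through `C` and `η`, so it is
uniform over the innovations. -/
lemma norm_charFun_sub_le [IsProbabilityMeasure P] {X : Ω → ℝ} (hm : Measurable X) (hX : MemLp X 2 P)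
    (h0 : ∫ ω, X ω ∂P = 0) (h1 : ∫ ω, X ω ^ 2 ∂P = 1) {C : ℝ≥0} {η : ℝ}
    (hη : ∫ ω, ({ω | C ≤ ‖X ω ^ 2‖₊}.indicator (fun ω => X ω ^ 2)) ω ∂P ≤ η) (s : ℝ) :
    ‖charFun (P.map X) s - (1 - (s : ℂ) ^ 2 / 2)‖ ≤ 4 * s ^ 2 * (η + |s| * √C) := by
  have hi1 : Integrable X P := hX.integrable (by norm_num)
  have hi2 : Integrable (fun ω => X ω ^ 2) P := hX.integrable_sq
  have hset : MeasurableSet {ω | C ≤ ‖X ω ^ 2‖₊} :=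
    measurableSet_le measurable_const (by fun_prop)
  have hc : charFun (P.map X) s = ∫ ω, Complex.exp ((s * X ω : ℝ) * Complex.I) ∂P := by
    rw [charFun_apply_real, integral_map hm.aemeasurable (by fun_prop)]
    simp
  have hiexp : Integrable (fun ω => Complex.exp ((s * X ω : ℝ) * Complex.I)) P := by
    refine Integrable.of_bound (by fun_prop) 1 (ae_of_all _ fun ω => ?_)
    rw [Complex.norm_exp_ofReal_mul_I]
  have hI1 : Integrable (fun ω => ((s * X ω : ℝ) : ℂ) * Complex.I) P :=
    ((hi1.const_mul s).ofReal).mul_const _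
  have hI2 : Integrable (fun ω => ((s * X ω : ℝ) : ℂ) ^ 2 / 2) P := by
    have := ((hi2.const_mul (s ^ 2)).ofReal (𝕜 := ℂ)).div_const 2
    refine this.congr (ae_of_all _ fun ω => ?_)
    simp; ring
  have hI3 : Integrable (fun ω => 1 + ((s * X ω : ℝ) : ℂ) * Complex.I) P :=
    (integrable_const _).add hI1
  have hI4 : Integrable (fun ω => 1 + ((s * X ω : ℝ) : ℂ) * Complex.I
      - ((s * X ω : ℝ) : ℂ) ^ 2 / 2) P := hI3.sub hI2
  have hpoly : ∫ ω, (1 + ((s * X ω : ℝ) : ℂ) * Complex.I - ((s * X ω : ℝ) : ℂ) ^ 2 / 2) ∂P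
      = 1 - (s : ℂ) ^ 2 / 2 := by
    rw [integral_sub hI3 hI2, integral_add (integrable_const _) hI1]
    have e1 : ∫ ω, ((s * X ω : ℝ) : ℂ) * Complex.I ∂P = 0 := by
      rw [integral_mul_const, integral_complex_ofReal, integral_const_mul, h0]; simp
    have e2 : ∫ ω, ((s * X ω : ℝ) : ℂ) ^ 2 / 2 ∂P = (s : ℂ) ^ 2 / 2 := by
      rw [integral_div]
      congr 1
      have : ∀ ω, ((s * X ω : ℝ) : ℂ) ^ 2 = ((s ^ 2 * X ω ^ 2 : ℝ) : ℂ) := by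
        intro ω; push_cast; ring
      simp_rw [this]
      rw [integral_complex_ofReal, integral_const_mul, h1]; simp
    rw [e1, e2]; simp
  rw [hc, ← hpoly, ← integral_sub hiexp hI4]
  refine (norm_integral_le_integral_norm _).trans ?_
  have hind : Integrable ({ω | C ≤ ‖X ω ^ 2‖₊}.indicator (fun ω => X ω ^ 2)) P :=
    hi2.indicator hset
  have hbd : ∫ ω, 4 * s ^ 2 * (({ω | C ≤ ‖X ω ^ 2‖₊}.indicator (fun ω => X ω ^ 2)) ω
      + |s| * √C * X ω ^ 2) ∂P ≤ 4 * s ^ 2 * (η + |s| * √C) := by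
    rw [integral_const_mul, integral_add hind (hi2.const_mul _), integral_const_mul, h1, mul_one]
    gcongr
  refine (integral_mono (hiexp.sub hI4).norm
    ((hind.add (hi2.const_mul _)).const_mul _) fun ω => ?_).trans hbd
  obtain ⟨b1, b2⟩ := norm_exp_mul_I_sub_taylor_le (s * X ω)
  simp only [Pi.sub_apply, Pi.add_apply]
  by_cases hω : C ≤ ‖X ω ^ 2‖₊
  · rw [indicator_of_mem (show ω ∈ {ω | C ≤ ‖X ω ^ 2‖₊} from hω)]
    refine b1.trans ?_
    have : 0 ≤ 4 * s ^ 2 * (|s| * √C * X ω ^ 2) := by positivity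
    nlinarith
  · rw [indicator_of_notMem (show ω ∉ {ω | C ≤ ‖X ω ^ 2‖₊} from hω)]
    refine b2.trans ?_
    have hlt : X ω ^ 2 ≤ C := by
      have := (not_le.1 hω).le
      have h' : ‖X ω ^ 2‖ ≤ C := by exact_mod_cast this
      simpa using h'
    have hle : |X ω| ≤ √C := by
      rw [← Real.sqrt_sq_eq_abs]; exact Real.sqrt_le_sqrt hlt
    have e : |s * X ω| ^ 3 = s ^ 2 * X ω ^ 2 * |s| * |X ω| := by
      rw [abs_mul, ← sq_abs s, ← sq_abs (X ω)]; ring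
    rw [e, zero_add]
    calc 4 * (s ^ 2 * X ω ^ 2 * |s| * |X ω|) ≤ 4 * (s ^ 2 * X ω ^ 2 * |s| * √C) := by gcongr
      _ = _ := by ring

lemma IsInnovationField.integral_sq {ε : Lattice d → Ω → ℝ} (hε : IsInnovationField P ε)
    (j : Lattice d) : ∫ ω, ε j ω ^ 2 ∂P = 1 := by
  have h := hε.variance_one j
  rw [variance_of_integral_eq_zero (hε.measurable j).aemeasurable (hε.mean_zero j)] at h
  simpa using h

/-- One truncation level serves all sites; this stands in for identical distribution. -/
lemma IsInnovationField.tail {ε : Lattice d → Ω → ℝ} (hε : IsInnovationField P ε) {η : ℝ}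
    (hη : 0 < η) : ∃ C : ℝ≥0, ∀ j,
      ∫ ω, ({ω | C ≤ ‖ε j ω ^ 2‖₊}.indicator (fun ω => ε j ω ^ 2)) ω ∂P ≤ η := by
  obtain ⟨C, hC⟩ := hε.sq_uniformIntegrable.spec one_ne_zero ENNReal.one_ne_top hη
  refine ⟨C, fun j => ?_⟩
  have h := hC j
  rw [eLpNorm_one_eq_lintegral_enorm] at h
  have hm := hε.measurable j
  have hset : MeasurableSet {ω | C ≤ ‖ε j ω ^ 2‖₊} :=
    measurableSet_le measurable_const (by fun_prop)
  rw [integral_eq_lintegral_of_nonneg_ae]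
  · refine ENNReal.toReal_le_of_le_ofReal hη.le (le_trans (le_of_eq ?_) h)
    refine lintegral_congr fun ω => ?_
    rw [← ofReal_norm, Real.norm_of_nonneg]
    exact indicator_nonneg (fun _ _ => sq_nonneg _) _
  · exact ae_of_all _ fun ω => indicator_nonneg (fun _ _ => sq_nonneg _) _
  · exact ((hm.pow_const 2).indicator hset).aestronglyMeasurable

/-- Lindeberg's theorem for finite weighted sums of innovations with asymptotically negligible
weights. -/
lemma IsInnovationField.tendstoNormal_sum [IsProbabilityMeasure P] {ε : Lattice d → Ω → ℝ} (hε : IsInnovationField P ε)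
    (s : ℕ → Finset (Lattice d)) (a : ℕ → Lattice d → ℝ) {m : ℕ → ℝ} {v : ℝ}
    (hm : Tendsto m atTop (𝓝 0)) (ham : ∀ n j, |a n j| ≤ m n)
    (hv : Tendsto (fun n => ∑ j ∈ s n, a n j ^ 2) atTop (𝓝 v)) :
    TendstoNormal P (fun n ω => ∑ j ∈ s n, a n j * ε j ω) v := by
  have hv0 : 0 ≤ v := ge_of_tendsto' hv fun n => Finset.sum_nonneg fun _ _ => sq_nonneg _
  have hmeas : ∀ n, Measurable (fun ω => ∑ j ∈ s n, a n j * ε j ω) := fun n =>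
    Finset.measurable_sum _ fun j _ => (hε.measurable j).const_mul _
  refine ⟨fun n => (hmeas n).aemeasurable, aemeasurable_id, ?_⟩
  refine ProbabilityMeasure.tendsto_iff_tendsto_charFun.2 fun t => ?_
  have hlim : charFun ((gaussianReal 0 v.toNNReal).map id) t
      = ((Real.exp (-(t ^ 2 * v / 2)) : ℝ) : ℂ) := by
    rw [Measure.map_id, charFun_gaussianReal]
    push_cast
    rw [Real.coe_toNNReal v hv0]
    congr 1
    ring
  have hprod : ∀ n, charFun (P.map fun ω => ∑ j ∈ s n, a n j * ε j ω) t
      = ∏ j ∈ s n, charFun (P.map (ε j)) (a n j * t) := by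
    intro n
    have hind : iIndepFun (fun j ω => a n j * ε j ω) P :=
      hε.indep.comp (fun j x => a n j * x) fun j => by fun_prop
    rw [(hind.restrict _).charFun_map_fun_finsetSum_eq_prod
      (fun j _ => ((hε.measurable j).const_mul _).aemeasurable), Finset.prod_apply]
    exact Finset.prod_congr rfl fun j _ => charFun_map_mul_comp (by simpa using (hε.measurable j).aemeasurable) _ _
  have hgauss : Tendsto (fun n => ((Real.exp (-(t ^ 2 * (∑ j ∈ s n, a n j ^ 2) / 2)) : ℝ) : ℂ))
      atTop (𝓝 ((Real.exp (-(t ^ 2 * v / 2)) : ℝ) : ℂ)) := by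
    refine (Complex.continuous_ofReal.tendsto _).comp ((Real.continuous_exp.tendsto _).comp ?_)
    exact ((hv.const_mul _).div_const _).neg
  change Tendsto (fun n => charFun (P.map fun ω => ∑ j ∈ s n, a n j * ε j ω) t) atTop
    (𝓝 (charFun ((gaussianReal 0 v.toNNReal).map id) t))
  rw [hlim]
  -- Compare with the Gaussian of the same variance at stage `n`; it factors over the same sites.
  refine (tendsto_iff_of_dist ?_).2 hgauss
  rw [Metric.tendsto_atTop]
  intro κ hκ
  -- `A` eventually dominates `∑ a²`, and `η` makes `4 t² A η ≤ κ / 4`; the `+ 1` in `t ^ 2 + 1`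
  -- covers `t = 0`.
  set A := v + 1 with hA
  have hA0 : 0 < A := by positivity
  set η := κ / (16 * (t ^ 2 + 1) * A) with hη
  have hη0 : 0 < η := by positivity
  obtain ⟨C, hC⟩ := hε.tail hη0
  have hsmall : Tendsto (fun n => t ^ 2 * A * (4 * (η + |t| * m n * √C) + t ^ 2 * m n ^ 2 / 4))
      atTop (𝓝 (t ^ 2 * A * (4 * (η + |t| * 0 * √C) + t ^ 2 * 0 ^ 2 / 4))) :=
    ((((((hm.const_mul |t|).mul_const (√C)).const_add η).const_mul 4).add
      (((hm.pow 2).const_mul (t ^ 2)).div_const 4)).const_mul (t ^ 2 * A))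
  have hlt : t ^ 2 * A * (4 * (η + |t| * 0 * √C) + t ^ 2 * 0 ^ 2 / 4) < κ := by
    have : t ^ 2 * A * (4 * (η + |t| * 0 * √C) + t ^ 2 * 0 ^ 2 / 4)
        = (t ^ 2 / (t ^ 2 + 1)) * (κ / 4) := by
      rw [hη]; field_simp; ring
    rw [this]
    have : t ^ 2 / (t ^ 2 + 1) ≤ 1 := by rw [div_le_one (by positivity)]; linarith
    nlinarith
  have hev := (hsmall.eventually (gt_mem_nhds hlt)).and
    (hv.eventually (gt_mem_nhds (show v < A by linarith)))
  obtain ⟨N, hN⟩ := eventually_atTop.1 hev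
  refine ⟨N, fun n hn => ?_⟩
  obtain ⟨h1, h2⟩ := hN n hn
  rw [Real.dist_eq, sub_zero, abs_of_nonneg dist_nonneg, hprod n, dist_eq_norm]
  refine lt_of_le_of_lt ?_ h1
  have hexp : ((Real.exp (-(t ^ 2 * (∑ j ∈ s n, a n j ^ 2) / 2)) : ℝ) : ℂ)
      = ∏ j ∈ s n, ((Real.exp (-((a n j * t) ^ 2 / 2)) : ℝ) : ℂ) := by
    rw [← Complex.ofReal_prod, ← Real.exp_sum]
    congr 2
    rw [Finset.mul_sum, Finset.sum_div, ← Finset.sum_neg_distrib]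
    exact Finset.sum_congr rfl fun j _ => by ring
  rw [hexp]
  refine (norm_prod_sub_prod_le_sum _ _ _ (fun j _ => ?_) fun j _ => ?_).trans ?_
  · have := Measure.isProbabilityMeasure_map (μ := P) (hε.measurable j).aemeasurable
    exact norm_charFun_le_one _
  · rw [Complex.norm_real, Real.norm_of_nonneg (Real.exp_pos _).le]
    simp; positivity
  · have hm0 : 0 ≤ m n := (abs_nonneg _).trans (ham n 0)
    calc ∑ j ∈ s n, ‖charFun (P.map (ε j)) (a n j * t)
            - ((Real.exp (-((a n j * t) ^ 2 / 2)) : ℝ) : ℂ)‖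
        ≤ ∑ j ∈ s n, a n j ^ 2 * (t ^ 2 * (4 * (η + |t| * m n * √C) + t ^ 2 * m n ^ 2 / 4)) := by
          refine Finset.sum_le_sum fun j _ => ?_
          have b1 := norm_charFun_sub_le (hε.measurable j) (hε.memLp j) (hε.mean_zero j)
            (hε.integral_sq j) (hC j) (a n j * t)
          have b2 := abs_exp_neg_sub_le (y := (a n j * t) ^ 2 / 2) (by positivity)
          have b3 : ‖(1 - ((a n j * t : ℝ) : ℂ) ^ 2 / 2)
              - ((Real.exp (-((a n j * t) ^ 2 / 2)) : ℝ) : ℂ)‖ ≤ ((a n j * t) ^ 2 / 2) ^ 2 := by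
            rw [norm_sub_rev]
            refine le_trans (le_of_eq ?_) b2
            rw [← Real.norm_eq_abs, ← Complex.norm_real]
            push_cast
            rfl
          refine (norm_sub_le_norm_sub_add_norm_sub _ (1 - ((a n j * t : ℝ) : ℂ) ^ 2 / 2) _).trans
            ((add_le_add b1 b3).trans ?_)
          have e1 : |a n j * t| ≤ |t| * m n := by
            rw [abs_mul, mul_comm]; gcongr; exact ham n j
          have e2 : a n j ^ 2 ≤ m n ^ 2 := by rw [← sq_abs]; gcongr; exact ham n j
          calc 4 * (a n j * t) ^ 2 * (η + |a n j * t| * √C) + ((a n j * t) ^ 2 / 2) ^ 2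
              = a n j ^ 2 * (t ^ 2 * (4 * (η + |a n j * t| * √C) + t ^ 2 * a n j ^ 2 / 4)) := by
                ring
            _ ≤ _ := by gcongr
      _ = (∑ j ∈ s n, a n j ^ 2) * (t ^ 2 * (4 * (η + |t| * m n * √C) + t ^ 2 * m n ^ 2 / 4)) := by
          rw [Finset.sum_mul]
      _ ≤ A * (t ^ 2 * (4 * (η + |t| * m n * √C) + t ^ 2 * m n ^ 2 / 4)) := by gcongr
      _ = _ := by ring

end CharFun

end SpatialCLT

/-! ### Edge weights and the central limit theorem for the linear process. -/

namespace SpatialCLT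

variable {d : ℕ}

lemma dataSites_finite {R : Set (Space d)} (hR : Bornology.IsBounded R) :
    (dataSites R).Finite := by
  obtain ⟨r, hr⟩ := hR.subset_closedBall 0
  refine (Set.finite_Icc (fun _ : Fin d => -⌈r⌉) (fun _ => ⌈r⌉)).subset fun k hk => ?_
  have h1 : ‖toSpace k‖ ≤ r := by simpa using hr hk
  have h2 : ∀ i, |(k i : ℝ)| ≤ r := fun i => (PiLp.norm_apply_le (toSpace k) i).trans h1
  refine ⟨fun i => ?_, fun i => ?_⟩
  · have := (abs_le.1 (h2 i)).1
    have h3 := Int.le_ceil r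
    have : (-(⌈r⌉ : ℤ) : ℝ) ≤ k i := by linarith
    exact_mod_cast this
  · have := (abs_le.1 (h2 i)).2
    have h3 := Int.le_ceil r
    have : (k i : ℝ) ≤ (⌈r⌉ : ℤ) := by linarith
    exact_mod_cast this

lemma toSpace_sub (k l : Lattice d) : toSpace (k - l) = toSpace k - toSpace l := by
  ext i; simp [toSpace]

lemma toSpace_add (k l : Lattice d) : toSpace (k + l) = toSpace k + toSpace l := by
  ext i; simp [toSpace]

/-- In this form `theta α R i` is visibly the coefficient of `ε i` in the sum of `Z k` over the
sites `k` of `R`. -/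
lemma theta_eq_finsum (α : Lattice d → ℝ) (R : Set (Space d)) (i : Lattice d) :
    theta α R i = ∑ᶠ k ∈ dataSites R, α (k - i) := by
  have h : dataSites ((fun x => x - toSpace i) '' R) = (fun k => k - i) '' dataSites R := by
    ext k
    simp only [dataSites, mem_ofPred_eq, mem_image]
    constructor
    · rintro ⟨x, hx, hxk⟩
      refine ⟨k + i, ?_, by simp⟩
      rw [toSpace_add, ← hxk]
      simpa using hx
    · rintro ⟨l, hl, rfl⟩
      exact ⟨_, hl, (toSpace_sub l i).symm⟩
  rw [theta, h, finsum_mem_image]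
  exact (sub_left_injective).injOn

lemma theta_eq_sum (α : Lattice d → ℝ) {R : Set (Space d)} (hR : (dataSites R).Finite)
    (i : Lattice d) : theta α R i = ∑ k ∈ hR.toFinset, α (k - i) := by
  rw [theta_eq_finsum, finsum_mem_eq_finite_toFinset_sum]

/-- The bound involves neither `F` nor `j`, which yields uniform negligibility of the normalised
weights. -/
lemma abs_sum_translates_le {α : Lattice d → ℝ} (hα : Summable α) (F : Finset (Lattice d))
    (j : Lattice d) : |∑ k ∈ F, α (k - j)| ≤ ∑' k, |α k| := by
  classical
  refine (Finset.abs_sum_le_sum_abs _ _).trans ?_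
  have e : ∑ k ∈ F, |α (k - j)| = ∑ k ∈ F.map (Equiv.subRight j).toEmbedding, |α k| := by
    simp
  rw [e]
  exact hα.abs.sum_le_tsum _ fun _ _ => abs_nonneg _

lemma summable_sum_translates {α : Lattice d → ℝ} (hα : Summable α) (F : Finset (Lattice d)) :
    Summable fun j => ∑ k ∈ F, α (k - j) :=
  summable_sum fun k _ => (Equiv.subLeft k).summable_iff.2 hα

lemma summable_sq_sum_translates {α : Lattice d → ℝ} (hα : Summable α)
    (F : Finset (Lattice d)) : Summable fun j => (∑ k ∈ F, α (k - j)) ^ 2 := by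
  refine Summable.of_nonneg_of_le (fun _ => sq_nonneg _) (fun j => ?_)
    ((summable_sum_translates hα F).abs.mul_left (∑' k, |α k|))
  rw [← sq_abs, sq]
  gcongr
  exact abs_sum_translates_le hα F j

section LinearProcess

variable {Ω : Type*} [MeasurableSpace Ω] {P : Measure Ω} {μ : ℝ}
  {α : Lattice d → ℝ} {ε Z : Lattice d → Ω → ℝ}

lemma IsLinearProcess.tendsto_eLpNorm_sum (hε : IsInnovationField P ε)
    (hZ : IsLinearProcess P μ α ε Z) [IsProbabilityMeasure P] (F : Finset (Lattice d)) :
    Tendsto (fun s : Finset (Lattice d) => eLpNorm (fun ω => ∑ i ∈ F, Z i ω -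
      (F.card * μ + ∑ j ∈ s, (∑ i ∈ F, α (i - j)) * ε j ω)) 2 P) atTop (𝓝 0) := by
  have h : Tendsto (fun s : Finset (Lattice d) => ∑ i ∈ F,
      eLpNorm (fun ω => Z i ω - (μ + ∑ j ∈ s, α (i - j) * ε j ω)) 2 P) atTop (𝓝 0) := by
    have := tendsto_finsetSum F fun i _ => hZ.tendsto_partialSums i
    simpa using this
  refine tendsto_of_tendsto_of_tendsto_of_le_of_le tendsto_const_nhds h (fun _ => zero_le)
    fun s => ?_
  have e : (fun ω => ∑ i ∈ F, Z i ω - (F.card * μ + ∑ j ∈ s, (∑ i ∈ F, α (i - j)) * ε j ω))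
      = ∑ i ∈ F, fun ω => Z i ω - (μ + ∑ j ∈ s, α (i - j) * ε j ω) := by
    ext ω
    simp only [Finset.sum_apply, Finset.sum_sub_distrib, Finset.sum_add_distrib, Finset.sum_const,
      nsmul_eq_mul, Finset.sum_mul]
    rw [Finset.sum_comm]
  simp only [e]
  refine eLpNorm_sum_le (fun i _ => ?_) (by norm_num)
  refine ((hZ.aemeasurable i).sub ?_).aestronglyMeasurable
  exact (measurable_const.add (Finset.measurable_sum _ fun j _ =>
    (hε.measurable j).const_mul _)).aemeasurable

lemma IsLinearProcess.memLp (hε : IsInnovationField P ε)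
    (hZ : IsLinearProcess P μ α ε Z) [IsProbabilityMeasure P] (i : Lattice d) :
    MemLp (Z i) 2 P := by
  obtain ⟨s, hs⟩ := ((hZ.tendsto_partialSums i).eventually
    (gt_mem_nhds (show (0 : ℝ≥0∞) < 1 by norm_num))).exists
  have h2 : MemLp (fun ω => μ + ∑ j ∈ s, α (i - j) * ε j ω) 2 P :=
    (memLp_const μ).add (memLp_finsetSum _ fun j _ => (hε.memLp j).const_mul _)
  have h1 : MemLp (fun ω => Z i ω - (μ + ∑ j ∈ s, α (i - j) * ε j ω)) 2 P :=
    ⟨((hZ.aemeasurable i).aestronglyMeasurable.sub h2.1), hs.trans ENNReal.one_lt_top⟩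
  convert h1.add h2 using 1
  ext ω
  simp

lemma IsLinearProcess.integral_eq (hε : IsInnovationField P ε)
    (hZ : IsLinearProcess P μ α ε Z) [IsProbabilityMeasure P] (i : Lattice d) :
    ∫ ω, Z i ω ∂P = μ := by
  have hsum : ∀ s : Finset (Lattice d), MemLp (fun ω => μ + ∑ j ∈ s, α (i - j) * ε j ω) 2 P :=
    fun s => (memLp_const μ).add (memLp_finsetSum _ fun j _ => (hε.memLp j).const_mul _)
  have hint : ∀ s : Finset (Lattice d), ∫ ω, (μ + ∑ j ∈ s, α (i - j) * ε j ω) ∂P = μ := by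
    intro s
    have hi : ∀ j, Integrable (fun ω => α (i - j) * ε j ω) P := fun j =>
      ((hε.memLp j).integrable (by norm_num)).const_mul _
    rw [integral_add (integrable_const _) (integrable_finsetSum _ fun j _ => hi j),
      integral_finsetSum _ fun j _ => hi j]
    simp [integral_const_mul, hε.mean_zero]
  have hle : ∀ s : Finset (Lattice d), ENNReal.ofReal |∫ ω, Z i ω ∂P - μ| ≤
      eLpNorm (fun ω => Z i ω - (μ + ∑ j ∈ s, α (i - j) * ε j ω)) 2 P := by
    intro s
    have hZi := (hZ.memLp hε i).integrable (by norm_num)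
    have hSi := (hsum s).integrable (by norm_num)
    have e : ∫ ω, Z i ω ∂P - μ = ∫ ω, (Z i ω - (μ + ∑ j ∈ s, α (i - j) * ε j ω)) ∂P := by
      rw [integral_sub hZi hSi, hint]
    rw [e, ← Real.norm_eq_abs, ofReal_norm]
    refine (enorm_integral_le_lintegral_enorm _).trans ?_
    rw [← eLpNorm_one_eq_lintegral_enorm]
    exact eLpNorm_le_eLpNorm_of_exponent_le (by norm_num)
      ((hZi.sub hSi).aestronglyMeasurable)
  have h0 : ENNReal.ofReal |∫ ω, Z i ω ∂P - μ| ≤ 0 :=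
    ge_of_tendsto' (hZ.tendsto_partialSums i) hle
  have h1 := ENNReal.ofReal_eq_zero.1 (le_antisymm h0 zero_le)
  exact sub_eq_zero.1 (abs_eq_zero.1 (le_antisymm h1 (abs_nonneg _)))

/-- Asymptotic normality of rescaled partial sums of a linear process follows from the convergence
of the variances, once the rescaling tends to zero. -/
lemma IsLinearProcess.tendstoNormal (hε : IsInnovationField P ε)
    (hZ : IsLinearProcess P μ α ε Z) [IsProbabilityMeasure P] (hα : Summable α)
    (F : ℕ → Finset (Lattice d)) {b : ℕ → ℝ} (hb : Tendsto b atTop (𝓝 0)) {v : ℝ}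
    (hv : Tendsto (fun n => b n ^ 2 * ∑' j, (∑ k ∈ F n, α (k - j)) ^ 2) atTop (𝓝 v)) :
    TendstoNormal P
      (fun n ω => b n * (∑ i ∈ F n, Z i ω - ∫ ω', ∑ i ∈ F n, Z i ω' ∂P)) v := by
  have hmean : ∀ n, ∫ ω', ∑ i ∈ F n, Z i ω' ∂P = (F n).card * μ := by
    intro n
    rw [integral_finsetSum _ fun i _ => (hZ.memLp hε i).integrable (by norm_num)]
    simp [hZ.integral_eq hε]
  set θ : ℕ → Lattice d → ℝ := fun n j => ∑ k ∈ F n, α (k - j) with hθ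
  -- Diagonal choice: for each `n` one finite set captures both the series in `L²` and its variance
  -- up to `1 / (n + 1)`, so Lindeberg is needed for finite sums only.
  have hex : ∀ n : ℕ, ∃ s : Finset (Lattice d),
      eLpNorm (fun ω => b n * (∑ i ∈ F n, Z i ω - ((F n).card * μ + ∑ j ∈ s, θ n j * ε j ω))) 2 P
        ≤ ENNReal.ofReal (1 / (n + 1)) ∧
      |∑ j ∈ s, (b n * θ n j) ^ 2 - b n ^ 2 * ∑' j, θ n j ^ 2| ≤ 1 / (n + 1) := by
    intro n
    have hpos : (0 : ℝ) < 1 / (n + 1) := by positivity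
    have h1 : Tendsto (fun s : Finset (Lattice d) => eLpNorm (fun ω => b n *
        (∑ i ∈ F n, Z i ω - ((F n).card * μ + ∑ j ∈ s, θ n j * ε j ω))) 2 P) atTop (𝓝 0) := by
      have := ENNReal.Tendsto.const_mul (a := ‖b n‖ₑ) (hZ.tendsto_eLpNorm_sum hε (F n))
        (Or.inr enorm_ne_top)
      rw [mul_zero] at this
      refine this.congr fun s => ?_
      rw [← eLpNorm_const_smul]
      rfl
    have h2 : Tendsto (fun s : Finset (Lattice d) => ∑ j ∈ s, (b n * θ n j) ^ 2) atTop
        (𝓝 (b n ^ 2 * ∑' j, θ n j ^ 2)) := by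
      have := (summable_sq_sum_translates hα (F n)).hasSum.mul_left (b n ^ 2)
      simp only [mul_pow]
      exact this
    have h2' := (Metric.tendsto_nhds.1 h2) _ hpos
    obtain ⟨s, hs1, hs2⟩ := ((h1.eventually (gt_mem_nhds
      (ENNReal.ofReal_pos.2 hpos))).and h2').exists
    exact ⟨s, hs1.le, by rw [← Real.dist_eq]; exact hs2.le⟩
  choose s hs1 hs2 using hex
  have hone : Tendsto (fun n : ℕ => (1 : ℝ) / (n + 1)) atTop (𝓝 0) :=
    tendsto_one_div_add_atTop_nhds_zero_nat
  have hX : TendstoNormal P (fun n ω => ∑ j ∈ s n, (b n * θ n j) * ε j ω) v := by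
    refine hε.tendstoNormal_sum s (fun n j => b n * θ n j)
      (m := fun n => |b n| * ∑' k, |α k|) ?_ (fun n j => ?_) ?_
    · simpa using hb.abs.mul_const (∑' k, |α k|)
    · rw [abs_mul]
      gcongr
      exact abs_sum_translates_le hα _ _
    · have h0 : Tendsto (fun n => ∑ j ∈ s n, (b n * θ n j) ^ 2 - b n ^ 2 * ∑' j, θ n j ^ 2)
          atTop (𝓝 0) := squeeze_zero_norm (fun n => by simpa using hs2 n) hone
      refine (zero_add v ▸ h0.add hv).congr fun n => ?_
      simp only [hθ, sub_add_cancel]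
  have hYm : ∀ n, AEMeasurable (fun ω => b n * (∑ i ∈ F n, Z i ω - ∫ ω', ∑ i ∈ F n, Z i ω' ∂P))
      P := fun n =>
    ((Finset.aemeasurable_fun_sum _ fun i _ => hZ.aemeasurable i).sub aemeasurable_const).const_mul _
  -- Slutsky: the discarded remainder vanishes in `L²`, hence in measure.
  refine tendstoInDistribution_of_tendstoInMeasure_sub _ _ hX ?_ hYm
  refine tendstoInMeasure_of_tendsto_eLpNorm (p := 2) (by norm_num)
    (fun n => ((hYm n).sub (hX.forall_aemeasurable n)).aestronglyMeasurable)
    aestronglyMeasurable_const ?_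
  have hone' : Tendsto (fun n : ℕ => ENNReal.ofReal (1 / ((n : ℝ) + 1))) atTop (𝓝 0) := by
    simpa using ENNReal.tendsto_ofReal hone
  refine tendsto_of_tendsto_of_tendsto_of_le_of_le tendsto_const_nhds hone' (fun _ => zero_le)
    fun n => le_trans (le_of_eq ?_) (hs1 n)
  congr 1
  ext ω
  simp only [Pi.sub_apply, Pi.zero_apply, hmean, sub_zero]
  rw [← sub_sub, mul_sub _ _ (∑ j ∈ s n, θ n j * ε j ω), Finset.mul_sum]
  simp only [mul_assoc]

end LinearProcess

end SpatialCLT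

noncomputable section

namespace SpatialCLT

variable {d : ℕ}

/-! ### Lattice sums as integrals of step functions -/

lemma measurable_floorVec : Measurable (floorVec : Space d → Lattice d) :=
  measurable_pi_lambda _ fun i => Int.measurable_floor.comp (by fun_prop)

lemma volume_floorVec_preimage (k : Lattice d) :
    volume (floorVec ⁻¹' {k} : Set (Space d)) = 1 := by
  have e : (floorVec ⁻¹' {k} : Set (Space d)) =
      WithLp.ofLp ⁻¹' (Set.pi univ fun i => Ico (k i : ℝ) (k i + 1)) := by
    ext x
    simp [floorVec, funext_iff, Int.floor_eq_iff]
  rw [e, (PiLp.volume_preserving_ofLp (Fin d)).measure_preimage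
    (MeasurableSet.univ_pi fun i => measurableSet_Ico).nullMeasurableSet, Real.volume_pi_Ico]
  simp

/-- The fibres of `floorVec` are unit cubes. This is what turns lattice sums into integrals of step
functions. -/
lemma map_floorVec : (volume : Measure (Space d)).map floorVec = Measure.count := by
  refine Measure.ext_of_singleton fun k => ?_
  rw [Measure.map_apply measurable_floorVec (measurableSet_singleton k),
    volume_floorVec_preimage, Measure.count_singleton]

lemma measurable_floorVec_smul (lam : ℝ) : Measurable fun x : Space d => floorVec (lam • x) :=
  measurable_floorVec.comp (measurable_const_smul lam)

lemma map_floorVec_smul {lam : ℝ} (hl : 0 < lam) :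
    (volume : Measure (Space d)).map (fun x => floorVec (lam • x))
      = ENNReal.ofReal ((lam ^ d)⁻¹) • Measure.count := by
  have h := Measure.map_map (μ := (volume : Measure (Space d))) measurable_floorVec
    (measurable_const_smul lam)
  rw [Measure.map_addHaar_smul _ hl.ne', Measure.map_smul, map_floorVec] at h
  rw [abs_of_nonneg (by positivity)] at h
  simpa [Function.comp_def] using h.symm

lemma integrable_floorVec_smul {lam : ℝ} (hl : 0 < lam) {φ : Lattice d → ℝ}
    (hφ : Summable φ) : Integrable fun x : Space d => φ (floorVec (lam • x)) := by
  have h : Integrable φ (volume.map fun x : Space d => floorVec (lam • x)) := by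
    rw [map_floorVec_smul hl]
    refine Integrable.smul_measure ?_ ENNReal.ofReal_ne_top
    exact integrable_count_iff.2 hφ.abs
  exact h.comp_measurable (measurable_floorVec_smul lam)

lemma integral_floorVec_smul {lam : ℝ} (hl : 0 < lam) {φ : Lattice d → ℝ}
    (hφ : Summable φ) :
    ∫ x : Space d, φ (floorVec (lam • x)) = (lam ^ d)⁻¹ * ∑' k, φ k := by
  have h := integral_map (μ := (volume : Measure (Space d)))
    (measurable_floorVec_smul lam).aemeasurable
    (f := φ) (measurable_of_countable φ).aestronglyMeasurable
  have hi : Integrable φ Measure.count := integrable_count_iff.2 hφ.abs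
  rw [← h, map_floorVec_smul hl, integral_smul_measure,
    ENNReal.toReal_ofReal (by positivity), integral_countable hi]
  simp [measureReal_def]

/-- The grid point of mesh `1 / lam` below `x`. -/
def gridPoint (lam : ℝ) (x : Space d) : Space d := lam⁻¹ • toSpace (floorVec (lam • x))

lemma measurable_gridPoint (lam : ℝ) : Measurable (gridPoint lam : Space d → Space d) :=
  (measurable_of_countable toSpace).comp (measurable_floorVec_smul lam) |>.const_smul lam⁻¹

lemma norm_sub_toSpace_floorVec_le (x : Space d) : ‖x - toSpace (floorVec x)‖ ≤ √d := by
  rw [EuclideanSpace.norm_eq]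
  refine Real.sqrt_le_sqrt ?_
  have h : ∀ i : Fin d, ‖(x - toSpace (floorVec x)) i‖ ^ 2 ≤ 1 := by
    intro i
    have e : (x - toSpace (floorVec x)) i = Int.fract (x i) := by
      simp [toSpace, floorVec]
    rw [e, Real.norm_of_nonneg (Int.fract_nonneg _)]
    exact pow_le_one₀ (Int.fract_nonneg _) (Int.fract_lt_one _).le
  refine (Finset.sum_le_sum fun i _ => h i).trans ?_
  simp

lemma norm_sub_gridPoint_le {lam : ℝ} (hl : 0 < lam) (x : Space d) :
    ‖x - gridPoint lam x‖ ≤ √d / lam := by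
  have e : x - gridPoint lam x = lam⁻¹ • (lam • x - toSpace (floorVec (lam • x))) := by
    rw [smul_sub, inv_smul_smul₀ hl.ne', gridPoint]
  rw [e, norm_smul, Real.norm_of_nonneg (by positivity), div_eq_inv_mul]
  gcongr
  exact norm_sub_toSpace_floorVec_le _

/-! ### Increments of the indicator of a region -/

/-- A segment missing the frontier would be split by the disjoint open sets `interior R` and
`interior Rᶜ`. -/
lemma exists_mem_frontier_of_mem_of_notMem {R : Set (Space d)} {a b : Space d} (ha : a ∈ R)
    (hb : b ∉ R) : ∃ y ∈ frontier R, y ∈ segment ℝ a b := by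
  by_contra! hcon
  have hpre : IsPreconnected (segment ℝ a b) := (convex_segment a b).isPreconnected
  have hcov : segment ℝ a b ⊆ interior R ∪ interior Rᶜ := by
    intro y hy
    by_contra hn
    rw [mem_union, not_or, interior_compl, notMem_compl_iff] at hn
    exact hcon y ⟨hn.2, hn.1⟩ hy
  obtain ⟨y, -, h1, h2⟩ := hpre _ _ isOpen_interior isOpen_interior hcov
    ⟨a, left_mem_segment ℝ a b, by
      rcases hcov (left_mem_segment ℝ a b) with h | h
      · exact h
      · exact absurd ha (interior_subset h)⟩
    ⟨b, right_mem_segment ℝ a b, by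
      rcases hcov (right_mem_segment ℝ a b) with h | h
      · exact absurd (interior_subset h) hb
      · exact h⟩
  exact interior_subset h2 (interior_subset h1)

lemma exists_mem_frontier_of_indicator_ne {R : Set (Space d)} {a b : Space d}
    (h : R.indicator (1 : Space d → ℝ) a ≠ R.indicator (1 : Space d → ℝ) b) :
    ∃ y ∈ frontier R, ‖y - b‖ ≤ ‖a - b‖ := by
  by_cases ha : a ∈ R <;> by_cases hb : b ∈ R
  · simp [ha, hb] at h
  · obtain ⟨y, hy, hs⟩ := exists_mem_frontier_of_mem_of_notMem ha hb
    rw [segment_symm] at hs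
    refine ⟨y, hy, ?_⟩
    exact norm_sub_le_of_mem_segment hs
  · obtain ⟨y, hy, hs⟩ := exists_mem_frontier_of_mem_of_notMem hb ha
    refine ⟨y, hy, ?_⟩
    exact norm_sub_le_of_mem_segment hs
  · simp [ha, hb] at h

/-- The increment of the indicator function of `R` from `x` to `x + z`. -/
def incr (R : Set (Space d)) (x z : Space d) : ℝ :=
  R.indicator (1 : Space d → ℝ) (x + z) - R.indicator (1 : Space d → ℝ) x

lemma abs_incr_le_one (R : Set (Space d)) (x z : Space d) : |incr R x z| ≤ 1 := by
  unfold incr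
  by_cases h1 : x + z ∈ R <;> by_cases h2 : x ∈ R <;> simp [h1, h2]

/-- A lag shorter than the distance to the frontier cannot change membership. This hides the
behaviour of the kernel near the origin. -/
lemma incr_eq_zero {R : Set (Space d)} {x z : Space d} {r : ℝ}
    (hx : ∀ y ∈ frontier R, r < ‖y - x‖) (hz : ‖z‖ ≤ r) : incr R x z = 0 := by
  by_contra h
  obtain ⟨y, hy, hyx⟩ := exists_mem_frontier_of_indicator_ne (sub_ne_zero.1 h)
  have := hx y hy
  rw [add_sub_cancel_left] at hyx
  linarith

lemma measurable_incr {R : Set (Space d)} (hR : MeasurableSet R) :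
    Measurable fun p : Space d × Space d => incr R p.1 p.2 := by
  have h : Measurable (R.indicator (1 : Space d → ℝ)) := measurable_one.indicator hR
  exact (h.comp (measurable_fst.add measurable_snd)).sub (h.comp measurable_fst)

lemma lintegral_enorm_incr_le {R : Set (Space d)} (hR : MeasurableSet R) (z : Space d) :
    ∫⁻ x, ‖incr R x z‖ₑ ≤ 2 * volume R := by
  have hm : Measurable (R.indicator (1 : Space d → ℝ≥0∞)) := measurable_one.indicator hR
  calc ∫⁻ x, ‖incr R x z‖ₑ
      ≤ ∫⁻ x, (R.indicator (1 : Space d → ℝ≥0∞) (x + z)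
          + R.indicator (1 : Space d → ℝ≥0∞) x) := by
        refine lintegral_mono fun x => ?_
        unfold incr
        by_cases h1 : x + z ∈ R <;> by_cases h2 : x ∈ R <;> simp [h1, h2]
    _ = 2 * volume R := by
        rw [lintegral_add_right _ hm, lintegral_add_right_eq_self (R.indicator 1) z,
          lintegral_indicator_one hR, two_mul]

/-- Rounding moves `x + z` by at most two mesh errors and `x` by one, so an indicator changes only
within `2 * √d / lam` of the frontier. Translation invariance makes the bound uniform in `z`. -/
lemma lintegral_enorm_incr_sub_le {R : Set (Space d)} {lam : ℝ} (hl : 0 < lam)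
    (z : Space d) :
    ∫⁻ x, ‖incr R (gridPoint lam x) (gridPoint lam z) - incr R x z‖ₑ
      ≤ 2 * volume (Metric.cthickening (2 * √d / lam) (frontier R)) := by
  set K := Metric.cthickening (2 * √d / lam) (frontier R) with hK
  have hKm : MeasurableSet K := Metric.isClosed_cthickening.measurableSet
  have hm : Measurable (K.indicator (1 : Space d → ℝ≥0∞)) := measurable_one.indicator hKm
  have key : ∀ a b : Space d, ‖a - b‖ ≤ 2 * √d / lam →
      ‖R.indicator (1 : Space d → ℝ) a - R.indicator (1 : Space d → ℝ) b‖ₑ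
        ≤ K.indicator (1 : Space d → ℝ≥0∞) b := by
    intro a b hab
    by_cases he : R.indicator (1 : Space d → ℝ) a = R.indicator (1 : Space d → ℝ) b
    · simp [he]
    · obtain ⟨y, hy, hyb⟩ := exists_mem_frontier_of_indicator_ne he
      have hb : b ∈ K := Metric.mem_cthickening_of_dist_le b y _ _ hy (by
        rw [dist_eq_norm, norm_sub_rev]; exact hyb.trans hab)
      rw [indicator_of_mem hb]
      by_cases h1 : a ∈ R <;> by_cases h2 : b ∈ R <;> simp [h1, h2]
  calc ∫⁻ x, ‖incr R (gridPoint lam x) (gridPoint lam z) - incr R x z‖ₑ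
      ≤ ∫⁻ x, (K.indicator (1 : Space d → ℝ≥0∞) (x + z)
          + K.indicator (1 : Space d → ℝ≥0∞) x) := by
        refine lintegral_mono fun x => ?_
        have hx := norm_sub_gridPoint_le hl x
        have hz := norm_sub_gridPoint_le hl z
        rw [norm_sub_rev] at hx hz
        have e : incr R (gridPoint lam x) (gridPoint lam z) - incr R x z
            = (R.indicator (1 : Space d → ℝ) (gridPoint lam x + gridPoint lam z)
                - R.indicator (1 : Space d → ℝ) (x + z))
              - (R.indicator (1 : Space d → ℝ) (gridPoint lam x)
                - R.indicator (1 : Space d → ℝ) x) := by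
          unfold incr; ring
        rw [e]
        refine enorm_sub_le.trans (add_le_add (key _ _ ?_) (key _ _ ?_))
        · rw [add_sub_add_comm]
          refine (norm_add_le _ _).trans ((add_le_add hx hz).trans (le_of_eq ?_))
          ring
        · refine hx.trans ?_
          gcongr
          linarith [Real.sqrt_nonneg (d : ℝ)]
    _ = 2 * volume K := by
        rw [lintegral_add_right _ hm, lintegral_add_right_eq_self (K.indicator 1) z,
          lintegral_indicator_one hKm, two_mul]

/-! ### The edge weights as integrals -/

lemma toSpace_mem_smul_iff {R : Set (Space d)} {lam : ℝ} (hl : 0 < lam) (k : Lattice d) :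
    toSpace k ∈ lam • R ↔ lam⁻¹ • toSpace k ∈ R :=
  mem_smul_set_iff_inv_smul_mem₀ hl.ne' _ _

/-- Because the coefficients sum to zero, the weight `θ` is a lattice sum against increments of the
indicator function of the region. -/
lemma integral_incr_gridPoint {α : Lattice d → ℝ} (hA : HasSum α 0) {R : Set (Space d)}
    (hR : Bornology.IsBounded R) {lam : ℝ} (hl : 0 < lam) (x : Space d) :
    ∫ z, incr R (gridPoint lam x) (gridPoint lam z) * α (floorVec (lam • z))
      = (lam ^ d)⁻¹ * theta α (lam • R) (floorVec (lam • x)) := by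
  set i := floorVec (lam • x) with hi
  set I : Space d → ℝ := R.indicator (1 : Space d → ℝ) with hI
  have hfin : (dataSites (lam • R)).Finite := dataSites_finite (hR.smul₀ lam)
  set φ : Lattice d → ℝ := fun k =>
    incr R (lam⁻¹ • toSpace i) (lam⁻¹ • toSpace k) * α k with hφ
  have hφs : Summable φ := by
    refine Summable.of_norm_bounded hA.summable.abs fun k => ?_
    rw [hφ, norm_mul, Real.norm_eq_abs, Real.norm_eq_abs]
    exact mul_le_of_le_one_left (abs_nonneg _) (abs_incr_le_one _ _ _)
  have h1 := integral_floorVec_smul hl hφs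
  have h2 : ∀ k, φ k = I (lam⁻¹ • toSpace (k + i)) * α k - I (lam⁻¹ • toSpace i) * α k := by
    intro k
    simp only [hφ, incr, ← hI, toSpace_add, smul_add]
    rw [add_comm (lam⁻¹ • toSpace i), sub_mul]
  have h3 : Summable fun k => I (lam⁻¹ • toSpace (k + i)) * α k := by
    have := hφs.add (hA.summable.mul_left (I (lam⁻¹ • toSpace i)))
    refine this.congr fun k => ?_
    rw [h2]; ring
  have h4 : ∑' k, φ k = ∑' k, I (lam⁻¹ • toSpace (k + i)) * α k := by
    rw [tsum_congr h2, h3.tsum_sub (hA.summable.mul_left _), tsum_mul_left, hA.tsum_eq]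
    simp
  have h5 : ∑' k, I (lam⁻¹ • toSpace (k + i)) * α k
      = ∑' k, I (lam⁻¹ • toSpace k) * α (k - i) := by
    rw [← (Equiv.addRight i).tsum_eq fun k => I (lam⁻¹ • toSpace k) * α (k - i)]
    simp
  have h6 : ∑' k, I (lam⁻¹ • toSpace k) * α (k - i) = theta α (lam • R) i := by
    rw [theta_eq_sum α hfin, tsum_eq_sum (s := hfin.toFinset)]
    · refine Finset.sum_congr rfl fun k hk => ?_
      have hk' : lam⁻¹ • toSpace k ∈ R := (toSpace_mem_smul_iff hl k).1 (hfin.mem_toFinset.1 hk)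
      simp [hI, hk']
    · intro k hk
      have hk' : lam⁻¹ • toSpace k ∉ R := fun h =>
        hk (hfin.mem_toFinset.2 ((toSpace_mem_smul_iff hl k).2 h))
      simp [hI, hk']
  rw [← h6, ← h5, ← h4, ← h1]
  rfl

/-- Away from the boundary, integrating increments against `h` gives `G†` up to sign. -/
lemma sq_integral_incr_eq {R : Set (Space d)} (h : Space d → ℝ)
    {x : Space d} {r : ℝ} (hr : 0 ≤ r) (hx : ∀ y ∈ frontier R, r < ‖y - x‖)
    (hR : MeasurableSet R) :
    (∫ z, incr R x z * ({z | r ≤ ‖z‖}.indicator h z)) ^ 2 = daggerG R h x ^ 2 := by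
  have e1 : ∀ z, incr R x z * ({z | r ≤ ‖z‖}.indicator h z) = incr R x z * h z := by
    intro z
    by_cases hz : r ≤ ‖z‖
    · rw [indicator_of_mem (show z ∈ {z | r ≤ ‖z‖} from hz)]
    · rw [incr_eq_zero hx (not_le.1 hz).le, zero_mul, zero_mul]
  simp_rw [e1]
  have hxf : x ∉ frontier R := fun hf => by
    have := hx x hf
    simp at this
    linarith
  have key : ∀ B : Set (Space d), MeasurableSet B →
      ∫ y in B, h (y - x) = ∫ z, B.indicator (1 : Space d → ℝ) (x + z) * h z := by
    intro B hB
    rw [← integral_indicator hB, ← integral_add_left_eq_self _ x]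
    refine integral_congr_ae (ae_of_all _ fun z => ?_)
    by_cases hz : x + z ∈ B <;> simp [hz]
  unfold daggerG
  by_cases hxR : x ∈ R
  -- From a point of `R` the increment is minus the indicator of the complement; squaring removes
  -- the sign.
  · rw [if_pos hxR, key _ hR.compl, ← neg_sq (∫ z, incr R x z * h z), ← integral_neg]
    congr 1
    refine integral_congr_ae (ae_of_all _ fun z => ?_)
    by_cases hz : x + z ∈ R <;> simp [hz, hxR, incr]
  · rw [if_neg hxR, if_neg hxf, key _ hR]
    congr 1
    refine integral_congr_ae (ae_of_all _ fun z => ?_)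
    by_cases hz : x + z ∈ R <;> simp [hz, hxR, incr]

end SpatialCLT

end

/-! ### Stability of the smoothed increments in `L¹`, and the limit variance. -/

noncomputable section

namespace SpatialCLT

variable {d : ℕ}

lemma enorm_integral_incr_le (R : Set (Space d)) (a b : Space d → Space d) (c : Space d)
    (H : Space d → ℝ) : ‖∫ z, incr R (a c) (b z) * H z‖ₑ ≤ ∫⁻ z, ‖H z‖ₑ := by
  refine (enorm_integral_le_lintegral_enorm _).trans (lintegral_mono fun z => ?_)
  rw [enorm_mul]
  refine mul_le_of_le_one_left zero_le ?_
  rw [← ofReal_norm, Real.norm_eq_abs]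
  simpa using abs_incr_le_one R (a c) (b z)

/-- Discretizing the increments and perturbing the kernel changes the smoothed function little in
`L¹`. -/
lemma lintegral_enorm_integral_incr_sub_le {R : Set (Space d)} (hR : MeasurableSet R) {lam : ℝ}
    (hl : 0 < lam) {H H' : Space d → ℝ} (hH : Integrable H) (hH' : Integrable H') :
    ∫⁻ x, ‖(∫ z, incr R (gridPoint lam x) (gridPoint lam z) * H' z) - ∫ z, incr R x z * H z‖ₑ
      ≤ (2 * volume R + 2 * volume (Metric.cthickening (2 * √d / lam) (frontier R)))
          * (∫⁻ z, ‖H' z - H z‖ₑ)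
        + 2 * volume (Metric.cthickening (2 * √d / lam) (frontier R)) * ∫⁻ z, ‖H z‖ₑ := by
  set ω := volume (Metric.cthickening (2 * √d / lam) (frontier R)) with hω
  have hma : Measurable fun p : Space d × Space d =>
      incr R (gridPoint lam p.1) (gridPoint lam p.2) :=
    (measurable_incr hR).comp (((measurable_gridPoint lam).comp measurable_fst).prodMk
      ((measurable_gridPoint lam).comp measurable_snd))
  have hmb := measurable_incr hR
  have hi : ∀ {G : Space d → ℝ} (_ : Integrable G) {w : Space d → ℝ} (_ : Measurable w)
      (_ : ∀ z, |w z| ≤ 1), Integrable fun z => w z * G z := by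
    intro G hG w hw hb
    refine hG.norm.mono (hw.aestronglyMeasurable.mul hG.1) (ae_of_all _ fun z => ?_)
    rw [norm_mul, norm_norm, Real.norm_eq_abs]
    exact mul_le_of_le_one_left (norm_nonneg _) (hb z)
  have hD : AEMeasurable (fun z => ‖H' z - H z‖ₑ) := (hH'.1.sub hH.1).enorm
  have hN : AEMeasurable (fun z => ‖H z‖ₑ) := hH.1.enorm
  have hm1 : AEMeasurable (fun p : Space d × Space d =>
      ‖incr R (gridPoint lam p.1) (gridPoint lam p.2)‖ₑ * ‖H' p.2 - H p.2‖ₑ)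
      (volume.prod volume) := hma.enorm.aemeasurable.mul hD.comp_snd
  have hm2 : AEMeasurable (fun p : Space d × Space d =>
      ‖incr R (gridPoint lam p.1) (gridPoint lam p.2) - incr R p.1 p.2‖ₑ * ‖H p.2‖ₑ)
      (volume.prod volume) := (hma.sub hmb).enorm.aemeasurable.mul hN.comp_snd
  have hl' : ∀ {w : Space d × Space d → ℝ}, Measurable w → ∀ x, Measurable fun z => w (x, z) :=
    fun hw x => hw.comp (measurable_prodMk_left (x := x))
  have hr' : ∀ {w : Space d × Space d → ℝ}, Measurable w → ∀ z, Measurable fun x => w (x, z) :=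
    fun hw z => hw.comp (measurable_prodMk_right (y := z))
  have hpt : ∀ x, ‖(∫ z, incr R (gridPoint lam x) (gridPoint lam z) * H' z)
        - ∫ z, incr R x z * H z‖ₑ
      ≤ (∫⁻ z, ‖incr R (gridPoint lam x) (gridPoint lam z)‖ₑ * ‖H' z - H z‖ₑ)
        + ∫⁻ z, ‖incr R (gridPoint lam x) (gridPoint lam z) - incr R x z‖ₑ * ‖H z‖ₑ := by
    intro x
    have hw1 : Measurable fun z => incr R (gridPoint lam x) (gridPoint lam z) :=
      hl' hma x
    have hw2 : Measurable fun z => incr R x z := hl' hmb x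
    have i1 : Integrable fun z => incr R (gridPoint lam x) (gridPoint lam z) * H' z :=
      hi hH' (w := fun z => incr R (gridPoint lam x) (gridPoint lam z)) hw1
        fun z => abs_incr_le_one _ _ _
    have i2 : Integrable fun z => incr R x z * H z :=
      hi hH (w := fun z => incr R x z) hw2 fun z => abs_incr_le_one _ _ _
    have i3 : AEMeasurable fun z =>
      ‖incr R (gridPoint lam x) (gridPoint lam z)‖ₑ * ‖H' z - H z‖ₑ :=
      hw1.enorm.aemeasurable.mul hD
    rw [← integral_sub i1 i2, ← lintegral_add_left' i3]
    refine (enorm_integral_le_lintegral_enorm _).trans (lintegral_mono fun z => ?_)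
    have e : incr R (gridPoint lam x) (gridPoint lam z) * H' z - incr R x z * H z
        = incr R (gridPoint lam x) (gridPoint lam z) * (H' z - H z)
          + (incr R (gridPoint lam x) (gridPoint lam z) - incr R x z) * H z := by ring
    rw [e, ← enorm_mul, ← enorm_mul]
    exact enorm_add_le _ _
  refine (lintegral_mono hpt).trans ?_
  -- Integrate in `x` first: the increment bounds are uniform in `z`, so only the `L¹` norms of the
  -- kernels remain.
  have s1 := lintegral_lintegral_swap (f := fun x z =>
    ‖incr R (gridPoint lam x) (gridPoint lam z)‖ₑ * ‖H' z - H z‖ₑ) hm1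
  have s2 := lintegral_lintegral_swap (f := fun x z =>
    ‖incr R (gridPoint lam x) (gridPoint lam z) - incr R x z‖ₑ * ‖H z‖ₑ) hm2
  rw [lintegral_add_left' hm1.lintegral_prod_right', s1, s2]
  refine add_le_add ?_ ?_
  · rw [← lintegral_const_mul'' _ hD]
    refine lintegral_mono fun z => ?_
    have hw1 : Measurable fun x => incr R (gridPoint lam x) (gridPoint lam z) :=
      hr' hma z
    have hw2 : Measurable fun x => incr R x z := hr' hmb z
    rw [lintegral_mul_const _ hw1.enorm]
    gcongr
    calc ∫⁻ x, ‖incr R (gridPoint lam x) (gridPoint lam z)‖ₑ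
        ≤ ∫⁻ x, (‖incr R x z‖ₑ
            + ‖incr R (gridPoint lam x) (gridPoint lam z) - incr R x z‖ₑ) := by
          refine lintegral_mono fun x => ?_
          have := enorm_add_le (incr R x z)
            (incr R (gridPoint lam x) (gridPoint lam z) - incr R x z)
          rwa [add_sub_cancel] at this
      _ ≤ 2 * volume R + 2 * ω := by
          rw [lintegral_add_left hw2.enorm]
          exact add_le_add (lintegral_enorm_incr_le hR z) (lintegral_enorm_incr_sub_le hl z)
  · rw [← lintegral_const_mul'' _ hN]
    refine lintegral_mono fun z => ?_
    have hw : Measurable fun x =>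
        incr R (gridPoint lam x) (gridPoint lam z) - incr R x z :=
      (hr' hma z).sub (hr' hmb z)
    rw [lintegral_mul_const _ hw.enorm]
    gcongr
    exact lintegral_enorm_incr_sub_le hl z

lemma IsPrototypeRegion.isBounded {R₀ : Set (Space d)} (hR₀ : IsPrototypeRegion R₀) :
    Bornology.IsBounded R₀ := by
  refine (Metric.isBounded_iff_subset_closedBall 0).2 ⟨√d, fun x hx => ?_⟩
  rw [mem_closedBall_zero_iff, EuclideanSpace.norm_eq]
  refine Real.sqrt_le_sqrt ?_
  have h : ∀ i : Fin d, ‖x i‖ ^ 2 ≤ 1 := by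
    intro i
    obtain ⟨h1, h2⟩ := hR₀.subset_cube x hx i
    rw [Real.norm_eq_abs, sq_abs]
    nlinarith
  refine (Finset.sum_le_sum fun i _ => h i).trans ?_
  simp

lemma IsPrototypeRegion.isBounded_frontier {R₀ : Set (Space d)} (hR₀ : IsPrototypeRegion R₀) :
    Bornology.IsBounded (frontier R₀) :=
  hR₀.isBounded.closure.subset frontier_subset_closure

lemma IsPrototypeRegion.volume_ne_top {R₀ : Set (Space d)} (hR₀ : IsPrototypeRegion R₀) :
    volume R₀ ≠ ⊤ := hR₀.isBounded.measure_lt_top.ne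

/-- The thickenings have finite measure and decrease to the closed frontier, which is null. -/
lemma IsPrototypeRegion.tendsto_volume_cthickening {R₀ : Set (Space d)}
    (hR₀ : IsPrototypeRegion R₀) {lam : ℕ → ℝ} (hlam : Tendsto lam atTop atTop) :
    Tendsto (fun n => volume (Metric.cthickening (2 * √d / lam n) (frontier R₀))) atTop (𝓝 0) := by
  have h := tendsto_measure_cthickening_of_isClosed (μ := (volume : Measure (Space d)))
    (s := frontier R₀)
    ⟨1, one_pos, hR₀.isBounded_frontier.cthickening.measure_lt_top.ne⟩ isClosed_frontier
  rw [hR₀.volume_frontier] at h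
  exact h.comp (hlam.const_div_atTop _)

/-- Factor `a² - b² = (a + b)(a - b)`: increments are at most `1`, so `a + b` is bounded by the `L¹`
norms of the kernels, and `L¹` convergence passes to squares. -/
lemma tendsto_lintegral_enorm_sq_sub {R₀ : Set (Space d)}
    (hR₀ : IsPrototypeRegion R₀) {lam : ℕ → ℝ} (hpos : ∀ n, 0 < lam n)
    (hlam : Tendsto lam atTop atTop) {H' : ℕ → Space d → ℝ} {H : Space d → ℝ}
    (hH' : ∀ n, Integrable (H' n)) (hH : Integrable H)
    (hconv : Tendsto (fun n => ∫⁻ z, ‖H' n z - H z‖ₑ) atTop (𝓝 0)) :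
    Tendsto (fun n => ∫⁻ x,
      ‖(∫ z, incr R₀ (gridPoint (lam n) x) (gridPoint (lam n) z) * H' n z) ^ 2
        - (∫ z, incr R₀ x z * H z) ^ 2‖ₑ) atTop (𝓝 0) := by
  set N := ∫⁻ z, ‖H z‖ₑ with hN
  have hNt : N ≠ ⊤ := hH.2.ne
  set D : ℕ → ℝ≥0∞ := fun n => ∫⁻ z, ‖H' n z - H z‖ₑ with hD
  set ω : ℕ → ℝ≥0∞ := fun n => volume (Metric.cthickening (2 * √d / lam n) (frontier R₀)) with hω
  have hωt : Tendsto ω atTop (𝓝 0) := hR₀.tendsto_volume_cthickening hlam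
  have h2 : (2 : ℝ≥0∞) ≠ ⊤ := by norm_num
  have hω2 : Tendsto (fun n => 2 * ω n) atTop (𝓝 0) := by
    simpa using ENNReal.Tendsto.const_mul hωt (Or.inr h2)
  have hB : Tendsto (fun n => (2 * volume R₀ + 2 * ω n) * D n + 2 * ω n * N) atTop (𝓝 0) := by
    have a1 : Tendsto (fun n => 2 * volume R₀ + 2 * ω n) atTop (𝓝 (2 * volume R₀ + 0)) :=
      tendsto_const_nhds.add hω2
    have a2 := ENNReal.Tendsto.mul a1 (Or.inr ENNReal.zero_ne_top) hconv
      (Or.inr (by simpa using ENNReal.mul_ne_top h2 hR₀.volume_ne_top))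
    have a3 := ENNReal.Tendsto.mul_const hω2 (Or.inr hNt)
    simpa using a2.add a3
  have hC : Tendsto (fun n => (N + D n + N) * ((2 * volume R₀ + 2 * ω n) * D n + 2 * ω n * N))
      atTop (𝓝 0) := by
    have a1 : Tendsto (fun n => N + D n + N) atTop (𝓝 (N + 0 + N)) :=
      (tendsto_const_nhds.add hconv).add tendsto_const_nhds
    have := ENNReal.Tendsto.mul a1 (Or.inr ENNReal.zero_ne_top) hB
      (Or.inr (by simpa using hNt))
    simpa using this
  refine tendsto_of_tendsto_of_tendsto_of_le_of_le tendsto_const_nhds hC (fun _ => zero_le)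
    fun n => ?_
  have hNn : ∫⁻ z, ‖H' n z‖ₑ ≤ N + D n := by
    rw [hN, hD, ← lintegral_add_left' hH.1.enorm]
    refine lintegral_mono fun z => ?_
    have := enorm_add_le (H z) (H' n z - H z)
    rwa [add_sub_cancel] at this
  have hKt : N + D n + N ≠ ⊤ := by
    have : D n ≠ ⊤ := ((hH' n).sub hH).2.ne
    simp [hNt, this]
  calc ∫⁻ x, ‖(∫ z, incr R₀ (gridPoint (lam n) x) (gridPoint (lam n) z) * H' n z) ^ 2
        - (∫ z, incr R₀ x z * H z) ^ 2‖ₑ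
      ≤ ∫⁻ x, (N + D n + N) *
          ‖(∫ z, incr R₀ (gridPoint (lam n) x) (gridPoint (lam n) z) * H' n z)
            - ∫ z, incr R₀ x z * H z‖ₑ := by
        refine lintegral_mono fun x => ?_
        rw [sq_sub_sq, enorm_mul]
        gcongr
        refine (enorm_add_le _ _).trans (add_le_add ?_ ?_)
        · exact (enorm_integral_incr_le R₀ _ _ x (H' n)).trans hNn
        · exact enorm_integral_incr_le R₀ id id x H
    _ = (N + D n + N) * ∫⁻ x,
          ‖(∫ z, incr R₀ (gridPoint (lam n) x) (gridPoint (lam n) z) * H' n z)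
            - ∫ z, incr R₀ x z * H z‖ₑ := lintegral_const_mul' _ _ hKt
    _ ≤ _ := by
        gcongr
        exact lintegral_enorm_integral_incr_sub_le hR₀.isOpen.measurableSet (hpos n) hH (hH' n)

/-! ### The contribution of sites away from the boundary -/

lemma frontier_smul {R : Set (Space d)} {lam : ℝ} (hl : 0 < lam) :
    frontier (lam • R) = lam • frontier R :=
  ((Homeomorph.smulOfNeZero lam hl.ne').image_frontier R).symm

lemma isBounded_enlargement {A : Set (Space d)} (hA : Bornology.IsBounded A) (r : ℝ) :
    Bornology.IsBounded (enlargement A r) := by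
  refine (hA.cthickening (δ := r)).subset ?_
  rintro y ⟨z, hz, hzy⟩
  exact Metric.mem_cthickening_of_dist_le y z _ _ hz (by rwa [dist_eq_norm, norm_sub_rev])

lemma mem_dataSites_enlargement_iff {R : Set (Space d)} {lam : ℝ} (hl : 0 < lam) (δ : ℝ)
    (x : Space d) :
    floorVec (lam • x) ∈ dataSites (enlargement (frontier (lam • R)) (δ * lam)) ↔
      ∃ y ∈ frontier R, ‖y - gridPoint lam x‖ ≤ δ := by
  have hn : ∀ y : Space d, ‖lam • y - toSpace (floorVec (lam • x))‖
      = lam * ‖y - gridPoint lam x‖ := by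
    intro y
    rw [← Real.norm_of_nonneg hl.le, ← norm_smul, Real.norm_of_nonneg hl.le, smul_sub, gridPoint,
      smul_inv_smul₀ hl.ne']
  rw [frontier_smul hl]
  constructor
  · rintro ⟨_, ⟨y, hy, rfl⟩, h⟩
    refine ⟨y, hy, ?_⟩
    simp only [hn] at h
    rw [mul_comm] at h
    exact le_of_mul_le_mul_right h hl
  · rintro ⟨y, hy, h⟩
    refine ⟨lam • y, ⟨y, hy, rfl⟩, ?_⟩
    rw [hn, mul_comm]
    gcongr

/-- The sites at distance more than `δ * lam` from the boundary of `lam • R₀`. -/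
def farSites (R₀ : Set (Space d)) (lam δ : ℝ) : Set (Lattice d) :=
  (dataSites (enlargement (frontier (lam • R₀)) (δ * lam)))ᶜ

lemma summable_sq_theta {α : Lattice d → ℝ} (hα : Summable α) {R : Set (Space d)}
    (hR : (dataSites R).Finite) : Summable fun i => theta α R i ^ 2 := by
  simp_rw [theta_eq_sum α hR]
  exact summable_sq_sum_translates hα _

/-- At far points the kernel may be cut off near the origin without changing `θ` or `G†`, and the
cut-off kernels converge in `L¹`. The other points carry no `θ²`; there `(G†)²` is integrated over a
thin neighbourhood of the null frontier, which is small with `δ`. -/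
lemma eventually_farSites_sum_close {R₀ : Set (Space d)} (hR₀ : IsPrototypeRegion R₀)
    {α : Lattice d → ℝ} (hA : HasSum α 0) {lam : ℕ → ℝ} (hpos : ∀ n, 0 < lam n)
    (hlam : Tendsto lam atTop atTop) {c : ℕ → ℝ} {h : Space d → ℝ} (hm : AEMeasurable h)
    (hconv : ∀ ρ : ℝ, 0 < ρ → Tendsto (fun n => ∫⁻ z in {z : Space d | ρ ≤ ‖z‖},
      ‖c n * α (floorVec (lam n • z)) - h z‖ₑ) atTop (𝓝 0))
    (hG : MemLp (daggerG R₀ h) 2 volume) {η : ℝ} (hη : 0 < η) :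
    ∀ᶠ δ in 𝓝[>] (0 : ℝ), ∀ᶠ n in atTop,
      |c n ^ 2 * ((lam n ^ d) ^ 3)⁻¹ *
        (∑' i, (farSites R₀ (lam n) δ).indicator (fun i => theta α (lam n • R₀) i ^ 2) i)
        - ∫ x, daggerG R₀ h x ^ 2| ≤ η := by
  have hG2 : Integrable fun x => daggerG R₀ h x ^ 2 := hG.integrable_sq
  have hGm : AEMeasurable fun x => ‖daggerG R₀ h x ^ 2‖ₑ := hG2.1.enorm
  set ν : Measure (Space d) := volume.withDensity fun x => ‖daggerG R₀ h x ^ 2‖ₑ with hν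
  have hνfin : IsFiniteMeasure ν := isFiniteMeasure_withDensity hG2.2.ne
  have hη2 : 0 < η / 2 := by positivity
  have hνlim : Tendsto (fun δ => ν (Metric.cthickening (2 * δ) (frontier R₀))) (𝓝[>] 0) (𝓝 0) := by
    have h1 := tendsto_measure_cthickening_of_isClosed (μ := ν) (s := frontier R₀)
      ⟨1, one_pos, measure_ne_top _ _⟩ isClosed_frontier
    rw [withDensity_absolutelyContinuous _ _ hR₀.volume_frontier] at h1
    refine h1.comp ?_
    have : Tendsto (fun δ : ℝ => 2 * δ) (𝓝 0) (𝓝 (2 * 0)) := tendsto_id.const_mul 2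
    rw [mul_zero] at this
    exact this.mono_left nhdsWithin_le_nhds
  filter_upwards [hνlim.eventually (gt_mem_nhds (ENNReal.ofReal_pos.2 hη2)),
    self_mem_nhdsWithin] with δ hδν hδ
  have hδ0 : 0 < δ := hδ
  -- Half of `δ` is left to absorb the rounding error, eventually below `ρ`.
  set ρ := δ / 2 with hρ
  have hρ0 : 0 < ρ := by positivity
  set S : Set (Space d) := {z | ρ ≤ ‖z‖} with hS
  have hSm : MeasurableSet S := measurableSet_le measurable_const measurable_norm
  have hH'int : ∀ n, Integrable (S.indicator fun z => c n * α (floorVec (lam n • z))) := fun n =>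
    ((integrable_floorVec_smul (hpos n) hA.summable).const_mul (c n)).indicator hSm
  have hconv' : Tendsto (fun n => ∫⁻ z, ‖S.indicator (fun z => c n * α (floorVec (lam n • z))) z
      - S.indicator h z‖ₑ) atTop (𝓝 0) := by
    refine (hconv ρ hρ0).congr fun n => ?_
    rw [← lintegral_indicator hSm]
    refine lintegral_congr fun z => ?_
    by_cases hz : z ∈ S <;> simp [hz]
  -- `h` is integrable away from the origin because it lies at finite `L¹` distance from an
  -- integrable step function.
  have hHint : Integrable (S.indicator h) := by
    obtain ⟨n, hn⟩ := (hconv'.eventually (gt_mem_nhds ENNReal.zero_lt_top)).exists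
    have hmS : AEStronglyMeasurable (S.indicator h) volume :=
      (hm.indicator hSm).aestronglyMeasurable
    have h1 : Integrable fun z => S.indicator (fun z => c n * α (floorVec (lam n • z))) z
      - S.indicator h z := ⟨(hH'int n).1.sub hmS, hn⟩
    have h2 := (hH'int n).sub h1
    refine h2.congr (ae_of_all _ fun z => ?_)
    simp
  have hlim := tendsto_lintegral_enorm_sq_sub hR₀ hpos hlam hH'int hHint hconv'
  have hmesh : Tendsto (fun n => √d / lam n) atTop (𝓝 0) := hlam.const_div_atTop _
  filter_upwards [hlim.eventually (gt_mem_nhds (ENNReal.ofReal_pos.2 hη2)),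
    hmesh.eventually (gt_mem_nhds hρ0)] with n hn hmn
  have hl := hpos n
  have hfin : (dataSites (lam n • R₀)).Finite := dataSites_finite (hR₀.isBounded.smul₀ _)
  set φ : Lattice d → ℝ := fun i => (c n * (lam n ^ d)⁻¹) ^ 2 *
    (farSites R₀ (lam n) δ).indicator (fun i => theta α (lam n • R₀) i ^ 2) i with hφ
  have hφs : Summable φ := ((summable_sq_theta hA.summable hfin).indicator _).mul_left _
  have hφi := integrable_floorVec_smul hl hφs
  -- Of the three factors `lam⁻ᵈ`, two come from squaring `lam⁻ᵈ θ` and one is the volume of a cell.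
  have e1 : c n ^ 2 * ((lam n ^ d) ^ 3)⁻¹ *
      (∑' i, (farSites R₀ (lam n) δ).indicator (fun i => theta α (lam n • R₀) i ^ 2) i)
      = ∫ x : Space d, φ (floorVec (lam n • x)) := by
    rw [integral_floorVec_smul hl hφs, hφ, tsum_mul_left]
    ring
  rw [e1, ← integral_sub hφi hG2, ← ENNReal.ofReal_le_ofReal_iff hη.le, ← Real.norm_eq_abs,
    ofReal_norm]
  refine (enorm_integral_le_lintegral_enorm _).trans ?_
  set K := Metric.cthickening (2 * δ) (frontier R₀) with hK
  have hKm : MeasurableSet K := Metric.isClosed_cthickening.measurableSet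
  have hpt : ∀ x : Space d, ‖φ (floorVec (lam n • x)) - daggerG R₀ h x ^ 2‖ₑ
      ≤ ‖(∫ z, incr R₀ (gridPoint (lam n) x) (gridPoint (lam n) z) *
            S.indicator (fun z => c n * α (floorVec (lam n • z))) z) ^ 2
          - (∫ z, incr R₀ x z * S.indicator h z) ^ 2‖ₑ
        + K.indicator (fun x => ‖daggerG R₀ h x ^ 2‖ₑ) x := by
    intro x
    have hxg := norm_sub_gridPoint_le hl x
    by_cases hx : floorVec (lam n • x) ∈ farSites R₀ (lam n) δ
    · have hfar : ∀ y ∈ frontier R₀, δ < ‖y - gridPoint (lam n) x‖ := by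
        intro y hy
        by_contra hc
        exact hx ((mem_dataSites_enlargement_iff hl δ x).2 ⟨y, hy, not_lt.1 hc⟩)
      have hfar' : ∀ y ∈ frontier R₀, ρ < ‖y - x‖ := by
        intro y hy
        have := hfar y hy
        have h3 : ‖y - gridPoint (lam n) x‖ ≤ ‖y - x‖ + ‖x - gridPoint (lam n) x‖ :=
          norm_sub_le_norm_sub_add_norm_sub _ _ _
        linarith
      refine le_trans (le_of_eq ?_) le_self_add
      congr 2
      · have h4 : ∀ z, incr R₀ (gridPoint (lam n) x) (gridPoint (lam n) z) *
            S.indicator (fun z => c n * α (floorVec (lam n • z))) z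
            = c n * (incr R₀ (gridPoint (lam n) x) (gridPoint (lam n) z) *
              α (floorVec (lam n • z))) := by
          intro z
          by_cases hz : z ∈ S
          · rw [indicator_of_mem hz]; ring
          · have hz' : ‖gridPoint (lam n) z‖ ≤ δ := by
              have h5 := norm_sub_gridPoint_le hl z
              have h6 : ‖gridPoint (lam n) z‖ ≤ ‖z‖ + ‖z - gridPoint (lam n) z‖ := by
                rw [norm_sub_rev]; exact norm_le_norm_add_norm_sub' _ _
              have h7 : ‖z‖ < ρ := not_le.1 hz
              linarith
            rw [incr_eq_zero hfar hz']; ring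
        simp_rw [h4]
        rw [integral_const_mul, integral_incr_gridPoint hA hR₀.isBounded hl, hφ]
        simp only [indicator_of_mem hx]
        ring
      · exact (sq_integral_incr_eq h hρ0.le hfar' hR₀.isOpen.measurableSet).symm
    · have hx0 : φ (floorVec (lam n • x)) = 0 := by
        simp [hφ, indicator_of_notMem hx]
      have hx' := not_not.1 hx
      obtain ⟨y, hy, hyx⟩ := (mem_dataSites_enlargement_iff hl δ x).1 hx'
      have hxK : x ∈ K := Metric.mem_cthickening_of_dist_le x y _ _ hy (by
        rw [dist_eq_norm]
        have h3 : ‖x - y‖ ≤ ‖x - gridPoint (lam n) x‖ + ‖gridPoint (lam n) x - y‖ :=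
          norm_sub_le_norm_sub_add_norm_sub _ _ _
        rw [norm_sub_rev (gridPoint (lam n) x) y] at h3
        linarith)
      rw [hx0, zero_sub, enorm_neg, indicator_of_mem hxK]
      exact le_add_self
  refine (lintegral_mono hpt).trans ?_
  rw [lintegral_add_right' _ (hGm.indicator hKm), lintegral_indicator hKm,
    ← withDensity_apply _ hKm, ← hν, show η = η / 2 + η / 2 by ring,
    ENNReal.ofReal_add hη2.le hη2.le]
  exact add_le_add hn.le hδν.le

/-- The asymptotic variance: boundary contribution plus long-range contribution. -/
theorem tendsto_variance {R₀ : Set (Space d)} (hR₀ : IsPrototypeRegion R₀)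
    {α : Lattice d → ℝ} (hA : HasSum α 0) {lam : ℕ → ℝ} (hpos : ∀ n, 0 < lam n)
    (hlam : Tendsto lam atTop atTop) {r : ℕ → ℝ} {r₀ : ℝ} (hr : Tendsto r atTop (𝓝 r₀))
    {h : Space d → ℝ} (hm : AEMeasurable h)
    (hconv : ∀ ρ : ℝ, 0 < ρ → Tendsto (fun n => ∫⁻ z in {z : Space d | ρ ≤ ‖z‖},
      ‖r n * lam n ^ ((d : ℝ) + 1 / 2) * α (floorVec (lam n • z)) - h z‖ₑ) atTop (𝓝 0))
    (hG : MemLp (daggerG R₀ h) 2 volume) {σ2 : ℝ} (hedge : EdgeCondition α R₀ lam σ2) :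
    Tendsto (fun n => (r n * lam n ^ (-(((d : ℝ) - 1) / 2))) ^ 2 *
      ∑' i, theta α (lam n • R₀) i ^ 2) atTop
      (𝓝 (r₀ ^ 2 * σ2 + ∫ x, daggerG R₀ h x ^ 2)) := by
  have hscale : ∀ n, (r n * lam n ^ (-(((d : ℝ) - 1) / 2))) ^ 2
      = r n ^ 2 * lam n ^ (-((d : ℝ) - 1)) := by
    intro n
    rw [mul_pow, ← Real.rpow_mul_natCast (hpos n).le]
    congr 2
    push_cast; ring
  -- The exponent `d + 1/2` is critical: `2 (d + 1/2) - 3 d = -(d - 1)`, the order of the boundary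
  -- term.
  have hscale' : ∀ n, (r n * lam n ^ ((d : ℝ) + 1 / 2)) ^ 2 * ((lam n ^ d) ^ 3)⁻¹
      = r n ^ 2 * lam n ^ (-((d : ℝ) - 1)) := by
    intro n
    rw [mul_pow, mul_assoc, ← Real.rpow_mul_natCast (hpos n).le, ← pow_mul,
      ← Real.rpow_natCast (lam n) (d * 3), ← Real.rpow_neg (hpos n).le, ← Real.rpow_add (hpos n)]
    congr 2
    push_cast; ring
  have hsplit : ∀ n δ, ∑' i, theta α (lam n • R₀) i ^ 2
      = (∑ᶠ i ∈ dataSites (enlargement (frontier (lam n • R₀)) (δ * lam n)),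
          |theta α (lam n • R₀) i| ^ 2)
        + ∑' i, (farSites R₀ (lam n) δ).indicator (fun i => theta α (lam n • R₀) i ^ 2) i := by
    intro n δ
    have hs := summable_sq_theta hA.summable
      (dataSites_finite (hR₀.isBounded.smul₀ (lam n)))
    have hbf : Bornology.IsBounded (frontier (lam n • R₀)) :=
      (hR₀.isBounded.smul₀ (lam n)).closure.subset frontier_subset_closure
    have hfin := dataSites_finite (isBounded_enlargement hbf (δ * lam n))
    rw [finsum_mem_eq_finite_toFinset_sum _ hfin]
    have h1 := hs.sum_add_tsum_compl (s := hfin.toFinset)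
    have h2 := tsum_subtype (((hfin.toFinset : Set (Lattice d)))ᶜ)
      fun i => theta α (lam n • R₀) i ^ 2
    rw [← h1, farSites, h2, hfin.coe_toFinset]
    simp only [sq_abs]
  rw [Metric.tendsto_nhds]
  intro η hη
  -- The edge error is multiplied by `r n ^ 2`, eventually below `r₀ ^ 2 + 1`, so it costs at most
  -- `η / 4`.
  set κ := η / (4 * (r₀ ^ 2 + 1)) with hκ
  have hκ0 : 0 < κ := by positivity
  have hκη : (r₀ ^ 2 + 1) * κ = η / 4 := by rw [hκ]; field_simp
  have hr2 : Tendsto (fun n => r n ^ 2) atTop (𝓝 (r₀ ^ 2)) := hr.pow 2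
  have hrσ : Tendsto (fun n => |r n ^ 2 - r₀ ^ 2| * |σ2|) atTop (𝓝 0) := by
    have := ((hr2.sub_const (r₀ ^ 2)).abs).mul_const |σ2|
    simpa using this
  obtain ⟨δ, hδ1, hδ2⟩ := ((hedge.eventually (gt_mem_nhds (ENNReal.ofReal_pos.2 hκ0))).and
    (eventually_farSites_sum_close hR₀ hA hpos hlam hm hconv hG
      (show 0 < η / 4 by positivity))).exists
  filter_upwards [eventually_lt_of_limsup_lt hδ1, hδ2,
    hr2.eventually (gt_mem_nhds (lt_add_one (r₀ ^ 2))),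
    hrσ.eventually (gt_mem_nhds (show 0 < η / 4 by positivity))] with n h1 h2 h3 h4
  have h1' := (ENNReal.ofReal_lt_ofReal_iff hκ0).1 h1
  rw [hscale'] at h2
  rw [Real.dist_eq, hscale, hsplit n δ]
  set N := ∑ᶠ i ∈ dataSites (enlargement (frontier (lam n • R₀)) (δ * lam n)),
    |theta α (lam n • R₀) i| ^ 2
  set F := ∑' i, (farSites R₀ (lam n) δ).indicator (fun i => theta α (lam n • R₀) i ^ 2) i
  set I := ∫ x, daggerG R₀ h x ^ 2
  set p := lam n ^ (-((d : ℝ) - 1))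
  have e : r n ^ 2 * p * (N + F) - (r₀ ^ 2 * σ2 + I)
      = r n ^ 2 * (p * N - σ2) + ((r n ^ 2 - r₀ ^ 2) * σ2 + (r n ^ 2 * p * F - I)) := by ring
  have b1 : |r n ^ 2 * (p * N - σ2)| ≤ η / 4 := by
    rw [abs_mul, abs_of_nonneg (sq_nonneg _), ← hκη]
    gcongr
  have b2 : |(r n ^ 2 - r₀ ^ 2) * σ2| < η / 4 := by rwa [abs_mul]
  have t1 := abs_add_le (r n ^ 2 * (p * N - σ2))
    ((r n ^ 2 - r₀ ^ 2) * σ2 + (r n ^ 2 * p * F - I))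
  have t2 := abs_add_le ((r n ^ 2 - r₀ ^ 2) * σ2) (r n ^ 2 * p * F - I)
  rw [e]
  linarith

end SpatialCLT

end

/-! ### Rescaled coefficients under regular variation. -/

namespace SpatialCLT

variable {d : ℕ}

lemma finite_floorVec_image {B : Set (Space d)} (hB : Bornology.IsBounded B) :
    (floorVec '' B).Finite := by
  have h : Bornology.IsBounded (toSpace '' (floorVec '' B) : Set (Space d)) := by
    obtain ⟨r, hr⟩ := hB.subset_closedBall 0
    refine (Metric.isBounded_iff_subset_closedBall 0).2 ⟨r + √d, ?_⟩
    rintro _ ⟨_, ⟨x, hx, rfl⟩, rfl⟩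
    have h1 : ‖x‖ ≤ r := by simpa using hr hx
    have h2 := norm_sub_toSpace_floorVec_le x
    rw [mem_closedBall_zero_iff]
    rw [norm_sub_rev] at h2
    have h3 : ‖toSpace (floorVec x)‖ ≤ ‖x‖ + ‖toSpace (floorVec x) - x‖ :=
      norm_le_norm_add_norm_sub' _ _
    linarith
  exact (dataSites_finite h).subset fun k hk => mem_image_of_mem _ hk

/-- A bounded sphere meets finitely many cells, so the `sSup` is a genuine supremum and not the
default `0`. -/
lemma abs_le_radialMax (α : Lattice d → ℝ) (t : ℝ) {u : Space d} (hu : ‖u‖ = 1) :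
    |α (floorVec (t • u))| ≤ radialMax α t := by
  refine le_csSup ?_ (mem_image_of_mem _ hu)
  have hb : Bornology.IsBounded (t • {u : Space d | ‖u‖ = 1}) := by
    refine Bornology.IsBounded.smul₀ ?_ t
    refine (Metric.isBounded_iff_subset_closedBall 0).2 ⟨1, fun v hv => ?_⟩
    rw [mem_closedBall_zero_iff]
    exact le_of_eq hv
  refine (((finite_floorVec_image hb).image fun k => |α k|).subset ?_).bddAbove
  rintro _ ⟨v, hv, rfl⟩
  exact ⟨_, ⟨_, ⟨v, hv, rfl⟩, rfl⟩, rfl⟩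

/-- Polar coordinates: use the radial maximum at `t = lam * ‖z‖` in the direction `z / ‖z‖`. -/
lemma RegularRadialDecay.abs_coeff_le {α : Lattice d → ℝ} {β : ℝ} {L : ℝ → ℝ}
    (h : RegularRadialDecay α β L) {lam : ℝ} (hl : 0 < lam) {z : Space d} (hz : z ≠ 0) :
    lam ^ β * |α (floorVec (lam • z))| ≤ ‖z‖ ^ (-β) * L (lam * ‖z‖) := by
  have hz0 : 0 < ‖z‖ := norm_pos_iff.2 hz
  have hu : ‖(‖z‖⁻¹ • z : Space d)‖ = 1 := by
    rw [norm_smul, norm_inv, norm_norm, inv_mul_cancel₀ hz0.ne']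
  have h1 := abs_le_radialMax α (lam * ‖z‖) hu
  rw [smul_smul, mul_assoc, mul_inv_cancel₀ hz0.ne', mul_one,
    h.radialMax_eq _ (by positivity), Real.mul_rpow hl.le hz0.le] at h1
  calc lam ^ β * |α (floorVec (lam • z))|
      ≤ lam ^ β * (lam ^ (-β) * ‖z‖ ^ (-β) * L (lam * ‖z‖)) := by gcongr
    _ = (lam ^ β * lam ^ (-β)) * (‖z‖ ^ (-β) * L (lam * ‖z‖)) := by ring
    _ = _ := by rw [← Real.rpow_add hl, add_neg_cancel, Real.rpow_zero, one_mul]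

lemma setLIntegral_norm_rpow_neg_lt_top {β : ℝ} (hβ : (d : ℝ) < β) {ρ : ℝ} (hρ : 0 < ρ) :
    ∫⁻ z in {z : Space d | ρ ≤ ‖z‖}, ENNReal.ofReal (‖z‖ ^ (-β)) < ⊤ := by
  have hint : Integrable fun z : Space d => (1 / ρ + 1) ^ β * (1 + ‖z‖) ^ (-β) :=
    (integrable_one_add_norm (by simpa using hβ)).const_mul _
  have hSm : MeasurableSet {z : Space d | ρ ≤ ‖z‖} :=
    measurableSet_le measurable_const measurable_norm
  have hβ0 : 0 ≤ β := (Nat.cast_nonneg d).trans hβ.le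
  refine lt_of_le_of_lt ?_ hint.lintegral_lt_top
  refine (setLIntegral_mono_ae (by fun_prop) (ae_of_all _ fun z hz => ?_)).trans
    (setLIntegral_le_lintegral _ _)
  refine ENNReal.ofReal_le_ofReal ?_
  have hz' : ρ ≤ ‖z‖ := hz
  have hz0 : 0 < ‖z‖ := hρ.trans_le hz'
  have h1 : 1 + ‖z‖ ≤ (1 / ρ + 1) * ‖z‖ := by
    have : 1 ≤ 1 / ρ * ‖z‖ := by
      rw [one_div, inv_mul_eq_div]; exact (one_le_div hρ).2 hz'
    linarith
  have h2 := Real.rpow_le_rpow_of_nonpos (by positivity) h1 (neg_nonpos.2 hβ0)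
  rw [Real.mul_rpow (by positivity) hz0.le] at h2
  calc ‖z‖ ^ (-β) = (1 / ρ + 1) ^ β * ((1 / ρ + 1) ^ (-β) * ‖z‖ ^ (-β)) := by
        rw [← mul_assoc, ← Real.rpow_add (by positivity), add_neg_cancel, Real.rpow_zero, one_mul]
    _ ≤ _ := by gcongr

/-- If the slowly varying factor vanishes at infinity, the rescaled coefficients vanish in `L¹` away
from the origin. -/
lemma RegularRadialDecay.tendsto_lintegral_zero {α : Lattice d → ℝ} {β : ℝ} {L : ℝ → ℝ}
    (h : RegularRadialDecay α β L) (hβ : (d : ℝ) < β) (hL : Tendsto L atTop (𝓝 0)) {lam : ℕ → ℝ}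
    (hpos : ∀ n, 0 < lam n) (hlam : Tendsto lam atTop atTop) {ρ : ℝ} (hρ : 0 < ρ) :
    Tendsto (fun n => ∫⁻ z in {z : Space d | ρ ≤ ‖z‖},
      ‖lam n ^ β * α (floorVec (lam n • z))‖ₑ) atTop (𝓝 0) := by
  set C := ∫⁻ z in {z : Space d | ρ ≤ ‖z‖}, ENNReal.ofReal (‖z‖ ^ (-β)) with hC
  have hCt : C ≠ ⊤ := (setLIntegral_norm_rpow_neg_lt_top hβ hρ).ne
  rw [ENNReal.tendsto_nhds_zero]
  intro η hη
  have hsmall : Tendsto (fun κ : ℝ => ENNReal.ofReal κ * C) (𝓝[>] 0) (𝓝 0) := by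
    have h1 : Tendsto (fun κ : ℝ => ENNReal.ofReal κ * C) (𝓝 0) (𝓝 (ENNReal.ofReal 0 * C)) :=
      ENNReal.Tendsto.mul_const (ENNReal.tendsto_ofReal tendsto_id) (Or.inr hCt)
    rw [ENNReal.ofReal_zero, zero_mul] at h1
    exact h1.mono_left nhdsWithin_le_nhds
  obtain ⟨κ, hκ1, hκ2⟩ := ((hsmall.eventually (gt_mem_nhds hη)).and self_mem_nhdsWithin).exists
  have hκ0 : 0 < κ := hκ2
  -- For `‖z‖ ≥ ρ` the argument of `L` is at least `lam n * ρ`, so one threshold serves all `z`; the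
  -- integrable factor `‖z‖ ^ (-β)` does the rest.
  obtain ⟨T, hT⟩ := eventually_atTop.1 (hL.eventually (gt_mem_nhds hκ0))
  filter_upwards [(hlam.atTop_mul_const hρ).eventually_ge_atTop T] with n hn
  refine le_trans ?_ hκ1.le
  rw [hC, ← lintegral_const_mul' _ _ ENNReal.ofReal_ne_top]
  refine setLIntegral_mono_ae (by fun_prop) (ae_of_all _ fun z hz => ?_)
  have hz' : ρ ≤ ‖z‖ := hz
  have hz0 : z ≠ 0 := norm_pos_iff.1 (hρ.trans_le hz')
  rw [← ofReal_norm, ← ENNReal.ofReal_mul hκ0.le]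
  refine ENNReal.ofReal_le_ofReal ?_
  rw [norm_mul, Real.norm_of_nonneg (Real.rpow_nonneg (hpos n).le _), Real.norm_eq_abs, mul_comm κ]
  refine (h.abs_coeff_le (hpos n) hz0).trans ?_
  have hLz : L (lam n * ‖z‖) < κ := hT _ (hn.trans (by have := hpos n; gcongr))
  gcongr

lemma RegularRadialDecay.rescaledCoeff_eq {α : Lattice d → ℝ} {β : ℝ} {L : ℝ → ℝ}
    (h : RegularRadialDecay α β L) {lam : ℝ} (hl : 0 < lam) (z : Space d) :
    rescaledCoeff α lam z = (L lam)⁻¹ * lam ^ β * α (floorVec (lam • z)) := by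
  rw [rescaledCoeff, h.radialMax_eq lam hl, Real.rpow_neg hl.le, div_eq_mul_inv, mul_inv, inv_inv]
  ring

lemma IsCoeffLimit.tendsto_lintegral_enorm {α : Lattice d → ℝ} {β : ℝ} {g : Space d → ℝ}
    (hg : IsCoeffLimit α β g) (hβ : (d : ℝ) < β) {L : ℝ → ℝ} (h : RegularRadialDecay α β L)
    {lam : ℕ → ℝ} (hpos : ∀ n, 0 < lam n) (hlam : Tendsto lam atTop atTop) {ρ : ℝ} (hρ : 0 < ρ) :
    Tendsto (fun n => ∫⁻ z in {z : Space d | ρ ≤ ‖z‖},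
      ‖(L (lam n))⁻¹ * lam n ^ β * α (floorVec (lam n • z)) - g z‖ₑ) atTop (𝓝 0) := by
  refine ((hg.tendsto_lintegral ρ hρ).comp hlam).congr fun n => ?_
  refine lintegral_congr fun z => ?_
  rw [← h.rescaledCoeff_eq (hpos n), limitExponent, if_neg (not_le.2 hβ), pow_one,
    ← Real.norm_eq_abs, ofReal_norm]

lemma daggerG_zero (R : Set (Space d)) : daggerG R (fun _ => 0) = fun _ => 0 := by
  ext x
  simp [daggerG]

lemma siteSum_eq_sum {Ω : Type*} (Z : Lattice d → Ω → ℝ) {R : Set (Space d)}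
    (hR : (dataSites R).Finite) (ω : Ω) : siteSum Z R ω = ∑ i ∈ hR.toFinset, Z i ω :=
  finsum_mem_eq_finite_toFinset_sum _ hR

lemma tendsto_rpow_neg_half {lam : ℕ → ℝ} (hd : 2 ≤ d) (hlam : Tendsto lam atTop atTop) :
    Tendsto (fun n => lam n ^ (-(((d : ℝ) - 1) / 2))) atTop (𝓝 0) := by
  have h : (2 : ℝ) ≤ d := by exact_mod_cast hd
  exact (tendsto_rpow_neg_atTop (by linarith)).comp hlam

end SpatialCLT

/-! ### The three regimes of `L`. -/

open SpatialCLT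

theorem theorem4p4 {d : ℕ} (hd : 2 ≤ d)
    {Ω : Type*} [MeasurableSpace Ω] (P : Measure Ω) [IsProbabilityMeasure P]
    (μ : ℝ) (α : SpatialCLT.Lattice d → ℝ) (ε Z : SpatialCLT.Lattice d → Ω → ℝ)
    (hα : Summable fun i => α i ^ 2)
    (hε : SpatialCLT.IsInnovationField P ε)
    (hZ : SpatialCLT.IsLinearProcess P μ α ε Z)
    (R₀ : Set (SpatialCLT.Space d)) (hR₀ : SpatialCLT.IsPrototypeRegion R₀)
    (lam : ℕ → ℝ) (hlam_pos : ∀ n, 0 < lam n) (hlam : Tendsto lam atTop atTop)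
    (S : ℕ → Ω → ℝ) (hS : ∀ n, S n = SpatialCLT.siteSum Z (lam n • R₀))
    (β : ℝ) (hβ : β = (d : ℝ) + 1 / 2)
    (L : ℝ → ℝ) (hC1 : SpatialCLT.RegularRadialDecay α β L)
    (hA : HasSum α 0)
    (σ2 : ℝ) (hσ2 : 0 < σ2) (hedge : SpatialCLT.EdgeCondition α R₀ lam σ2) :
    (Tendsto L atTop (𝓝 0) →
      SpatialCLT.TendstoNormal P
        (fun n ω => lam n ^ (-(((d : ℝ) - 1) / 2)) * (S n ω - ∫ ω', S n ω' ∂P)) σ2) ∧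
    (∀ g : SpatialCLT.Space d → ℝ, SpatialCLT.IsCoeffLimit α β g →
      MemLp (SpatialCLT.daggerG R₀ g) 2 volume →
      (∀ c₀ : ℝ, 0 < c₀ → Tendsto L atTop (𝓝 c₀) →
        SpatialCLT.TendstoNormal P
          (fun n ω => lam n ^ (-(((d : ℝ) - 1) / 2)) * (S n ω - ∫ ω', S n ω' ∂P))
          (σ2 + c₀ ^ 2 * ∫ x, SpatialCLT.daggerG R₀ g x ^ 2)) ∧
      (Tendsto L atTop atTop →
        SpatialCLT.TendstoNormal P
          (fun n ω => (S n ω - ∫ ω', S n ω' ∂P) /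
            (lam n ^ (3 * (d : ℝ) - 2 * β) * L (lam n) ^ 2) ^ (1 / 2 : ℝ))
          (∫ x, SpatialCLT.daggerG R₀ g x ^ 2))) := by
  subst hβ
  have hβd : (d : ℝ) < (d : ℝ) + 1 / 2 := by linarith
  have hfin : ∀ n, (dataSites (lam n • R₀)).Finite := fun n =>
    dataSites_finite (hR₀.isBounded.smul₀ _)
  have hSum : ∀ n ω, S n ω = ∑ i ∈ (hfin n).toFinset, Z i ω := fun n ω => by
    rw [hS, siteSum_eq_sum]
  have hclt : ∀ {b : ℕ → ℝ} {v : ℝ}, Tendsto b atTop (𝓝 0) →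
      Tendsto (fun n => b n ^ 2 * ∑' i, theta α (lam n • R₀) i ^ 2) atTop (𝓝 v) →
      TendstoNormal P (fun n ω => b n * (S n ω - ∫ ω', S n ω' ∂P)) v := by
    intro b v hb hv
    simp only [hSum]
    refine hZ.tendstoNormal hε hA.summable (fun n => (hfin n).toFinset) hb ?_
    simpa only [theta_eq_sum α (hfin _)] using hv
  have hp0 := tendsto_rpow_neg_half hd hlam
  refine ⟨fun hL => ?_, fun g hg hG => ⟨fun c₀ hc₀ hL => ?_, fun hL => ?_⟩⟩
  -- With `L → 0` the limit kernel is `0`, so only the boundary term survives.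
  · have hv := tendsto_variance hR₀ hA hlam_pos hlam (r := fun _ => 1) tendsto_const_nhds
      (h := fun _ => 0) aemeasurable_const (fun ρ hρ => by
        simpa using hC1.tendsto_lintegral_zero hβd hL hlam_pos hlam hρ)
      (by rw [daggerG_zero]; exact MemLp.zero) hedge
    refine hclt hp0 ?_
    simpa [daggerG_zero] using hv
  -- Normalise by `1 / L`, so that the kernels converge to `g`, then multiply the variance back by
  -- `L² → c₀²`.
  · have hLn : Tendsto (fun n => L (lam n)) atTop (𝓝 c₀) := hL.comp hlam
    have hv := tendsto_variance hR₀ hA hlam_pos hlam (hLn.inv₀ hc₀.ne') hg.aemeasurable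
      (fun ρ hρ => hg.tendsto_lintegral_enorm hβd hC1 hlam_pos hlam hρ) hG hedge
    refine hclt hp0 ?_
    have hv' := (hLn.pow 2).mul hv
    have e : c₀ ^ 2 * (c₀⁻¹ ^ 2 * σ2 + ∫ x, daggerG R₀ g x ^ 2)
        = σ2 + c₀ ^ 2 * ∫ x, daggerG R₀ g x ^ 2 := by
      field_simp
    rw [e] at hv'
    refine hv'.congr' ?_
    filter_upwards [hLn.eventually (lt_mem_nhds hc₀)] with n hn
    field_simp
  -- Here `r = 1 / L → 0` removes the boundary term.
  · have hLn : Tendsto (fun n => L (lam n)) atTop atTop := hL.comp hlam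
    have hv := tendsto_variance hR₀ hA hlam_pos hlam hLn.inv_tendsto_atTop hg.aemeasurable
      (fun ρ hρ => hg.tendsto_lintegral_enorm hβd hC1 hlam_pos hlam hρ) hG hedge
    have hb : Tendsto (fun n => (L (lam n))⁻¹ * lam n ^ (-(((d : ℝ) - 1) / 2))) atTop (𝓝 0) := by
      simpa using hLn.inv_tendsto_atTop.mul hp0
    have hN := hclt hb hv
    -- As `L ≥ 0` and `3 d - 2 β = d - 1`, the denominator is `lam n ^ ((d - 1) / 2) * L (lam n)`.
    convert hN using 3 with n ω
    · have hLnn : 0 ≤ L (lam n) := hC1.slowlyVarying.nonneg _ (hlam_pos n)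
      have hln := hlam_pos n
      rw [div_eq_inv_mul]
      congr 1
      rw [Real.mul_rpow (by positivity) (by positivity), ← Real.sqrt_eq_rpow (L (lam n) ^ 2),
        Real.sqrt_sq hLnn, ← Real.rpow_mul hln.le, mul_inv, ← Real.rpow_neg hln.le, mul_comm]
      congr 2
      ring
    · simp
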